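/- Let $f$ be a decreasing convex probability density on $(0,\infty)$ with distribution function $F(t)=\int_0^t f$. Put $\alpha_0(F)=\sup\{x:F(x)=0\}$, $\alpha_1(F)=\inf\{t:F(t)=1\}\in(0,\infty]$ and $F^{-1}(u)=\inf\{x:F(x)\ge u\}$. Fix $0<\tau<\alpha_1(F)$ and assume that $f$ is twice continuously differentiable on $[0,\tau]$ (so $F$ has a continuous third derivative there), and that $$\beta_2=\inf_{0<t<\tau}\frac{f''(t)}{f(t)^3}>0,\qquad \tilde\gamma_1=\sup_{0<t<\tau}\frac{-f'(t)}{f(t)^2}<\infty,\qquad R=\frac{\max\{1,\sup_{0<t<\tau}f(t)\}}{\inf_{0<t<\tau}f(t)}<\infty .$$ Let $X_1,\dots,X_n$ be i.i.d. with density $f$, let $\mathbb F_n(t)=n^{-1}\#\{i:X_i\le t\}$ and $\mathbb Y_n(t)=\int_0^t\mathbb F_n(s)\,ds$. For an integer $k\ge 2$ let $a_0=\alpha_0(F)=0$ and $a_j=F^{-1}(jF(\tau)/k)$, $1\le j\le k$ (so $a_k=\tau$), and let $\mathbb H_{n,k}$ be the complete cubic spline interpolant of $\mathbb Y_n$ at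 these knots: the $C^2$ function on $[0,\tau]$ that is a polynomial of degree at most $3$ on each $[a_{j-1},a_j]$, equals $\mathbb Y_n$ at $a_0,\dots,a_k$, and has derivative $\mathbb F_n(0)$ at $0$ and $\mathbb F_n(\tau)$ at $\tau$. Let $p=F(\tau)/k$, the $F$-probability of each interval $[a_{j-1},a_j]$. Then there is $k_0$, depending only on $F$ and $\tau$, such that for all $k\ge k_0$ and all $n\ge 1$ $$P\bigl(\mathbb H_{n,k}^{(2)}\text{ is not convex on }[0,\tau]\bigr)\le 12\,k\,\exp\bigl(-K\beta_2^2\,n\,p^5\bigr),\qquad K^{-1}=8^2\cdot144^2\cdot16\cdot200=4\,246\,732\,800 .$$ In particular, for every sequence of integers $k_n\to\infty$, the bound holds with $k=k_n$ and $p=p_n=F(\tau)/k_n$ for all sufficiently large $n$. -/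

import Mathlib

open Set MeasureTheory ProbabilityTheory

noncomputable section

namespace ConvexSpline

/-- `f` is (the restriction to `(0, ∞)` of) a decreasing convex probability density
on `(0, ∞)`. -/
structure IsDecreasingConvexDensity (f : ℝ → ℝ) : Prop where
  nonneg : ∀ x, 0 < x → 0 ≤ f x
  antitone : AntitoneOn f (Ioi 0)
  convex : ConvexOn ℝ (Ioi 0) f
  lintegral_eq_one : ∫⁻ x in Ioi (0 : ℝ), ENNReal.ofReal (f x) = 1

/-- The distribution on the real line with density `f` on `(0, ∞)`. -/
def law (f : ℝ → ℝ) : Measure ℝ :=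
  (volume.restrict (Ioi 0)).withDensity fun x => ENNReal.ofReal (f x)

/-- The distribution function `F` of the law with density `f`. -/
def distFun (f : ℝ → ℝ) (t : ℝ) : ℝ := (law f).real (Iic t)

/-- `α₀(F) = sup {x : F x = 0}`. -/
def alphaZero (F : ℝ → ℝ) : ℝ := sSup {x | F x = 0}

/-- `α₁(F) = inf {t : F t = 1}`, equal to `+∞` if `F` never reaches `1`. -/
def alphaOne (F : ℝ → ℝ) : EReal := ⨅ (t : ℝ) (_ : F t = 1), (t : EReal)

/-- The quantile function `F⁻¹(u) = inf {x : u ≤ F x}`. -/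
def quantile (F : ℝ → ℝ) (u : ℝ) : ℝ := sInf {x | u ≤ F x}

/-- The knots: `a₀ = α₀(F)` and `a_j = F⁻¹((j / k) F(τ))` for `1 ≤ j ≤ k`. -/
def knot (F : ℝ → ℝ) (τ : ℝ) (k j : ℕ) : ℝ :=
  if j = 0 then alphaZero F else quantile F ((j : ℝ) / k * F τ)

/-- `β₂(F, τ) = inf_{0 < t < τ} f''(t) / f(t)³`. As a real infimum it is `0` when the set is
not bounded below, so `0 < betaTwo f τ` does say that the infimum is positive. -/
def betaTwo (f : ℝ → ℝ) (τ : ℝ) : ℝ :=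
  sInf ((fun t => iteratedDeriv 2 f t / f t ^ 3) '' Ioo 0 τ)

/-- `γ̃₁(F, τ) = sup_{0 < t < τ} (- f'(t) / f(t)²)`, an extended real. -/
def gammaTildeOne (f : ℝ → ℝ) (τ : ℝ) : EReal :=
  ⨆ t ∈ Ioo 0 τ, ((-deriv f t / f t ^ 2 : ℝ) : EReal)

/-- `R(f, τ) = max {1, sup_{0 < t < τ} f t} / inf_{0 < t < τ} f t`, an extended nonnegative
real (it is `∞` if the infimum is `0` or the supremum is `∞`). -/
def ratioR (f : ℝ → ℝ) (τ : ℝ) : ENNReal :=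
  max 1 (⨆ t ∈ Ioo 0 τ, ENNReal.ofReal (f t)) / ⨅ t ∈ Ioo 0 τ, ENNReal.ofReal (f t)

/-- The empirical distribution function of the sample `x 0, …, x (n - 1)`. -/
def empDistFun {n : ℕ} (x : Fin n → ℝ) (t : ℝ) : ℝ :=
  ((Finset.univ.filter fun i => x i ≤ t).card : ℝ) / n

/-- `𝕐_n(t) = ∫₀ᵗ 𝔽_n(s) ds`. -/
def intEmpDistFun {n : ℕ} (x : Fin n → ℝ) (t : ℝ) : ℝ := ∫ s in (0 : ℝ)..t, empDistFun x s

/-- `H` is, on `[a 0, a k]`, a complete cubic spline interpolant of `g` with knots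
`a 0, …, a k`: it is piecewise cubic, of class `C²`, agrees with `g` at all the knots, and its
derivatives at the two end knots are the prescribed values `g' (a 0)` and `g' (a k)`, where `g'`
is the derivative of `g`. -/
structure IsCompleteCubicSpline (k : ℕ) (a : ℕ → ℝ) (g g' H : ℝ → ℝ) : Prop where
  contDiffOn : ContDiffOn ℝ 2 H (Icc (a 0) (a k))
  cubic : ∀ j < k, ∃ p : Polynomial ℝ, p.natDegree ≤ 3 ∧
    ∀ x ∈ Icc (a j) (a (j + 1)), H x = p.eval x
  interpolates : ∀ j ≤ k, H (a j) = g (a j)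
  deriv_left : derivWithin H (Icc (a 0) (a k)) (a 0) = g' (a 0)
  deriv_right : derivWithin H (Icc (a 0) (a k)) (a k) = g' (a k)

/-- The sample `x` is in the event `A_n`: the complete cubic spline interpolant of `𝕐_n`
(whose derivative is `𝔽_n`) at the knots `knot F τ k` exists, and its second derivative is
convex on `[0, τ]`. (The interpolant is unique on `[0, τ]`; quantifying over all `H` makes
the event independent of the values of `H` elsewhere.) -/
def SplineSecondDerivConvex (F : ℝ → ℝ) (τ : ℝ) (k : ℕ) {n : ℕ} (x : Fin n → ℝ) : Prop :=
  (∃ H, IsCompleteCubicSpline k (knot F τ k) (intEmpDistFun x) (empDistFun x) H) ∧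
  ∀ H, IsCompleteCubicSpline k (knot F τ k) (intEmpDistFun x) (empDistFun x) H →
    ConvexOn ℝ (Icc 0 τ) (iteratedDerivWithin 2 H (Icc 0 τ))

end ConvexSpline

end

/-! The second derivative of a cubic spline is continuous and piecewise affine, so it is convex as
soon as the jumps `E j` of the third derivative at the interior knots are nonnegative. Eliminating
slopes and second derivatives from the interpolation conditions gives a tridiagonal system `jumpOp h
E = fourthDiff h q`. Here `h` are the cell lengths and `q` the means of the empirical distribution
function over the cells. The clamped end conditions enter as two ghost cells of length zero, so that
boundary rows look like interior ones (`fourthDiff_eq_jumpOp`,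
`IsCompleteCubicSpline.exists_jumps`).

For large `k` the knots are locally almost equispaced, because a cell of probability `p` has length
`p / f ξ` and `f` is uniformly continuous. On such a mesh the system, scaled by squared cell
lengths, is diagonally dominant with inverse of norm at most 4 (`NearUniform.abs_mul_sq_le`). The
jumps are compared with the profile `E' j = f''(a j) * h j`. It satisfies `h j ^ 2 * E' j ≥ β₂ (f(a
j) * h j)³`, which is nearly `β₂ p³`.

With `T = β₂ p³ / 16`, two errors are each kept below `T`. The deterministic one, between `jumpOp h
E'` and the fourth differences of the true distribution function, is `o(p³)` by a Taylor expansion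
and the uniform continuity of `f''` (`NearUniform.fourthDiff_sub_jumpOp_le`). The random one is a
centred mean of variables bounded by 40 and supported on four cells, hence with second moment at
most `6400 p`. Bernstein's inequality bounds its failure probability by `2 exp(-n T² / (25600 p))`
(`NearUniform.measureReal_fourthDiff_ge_le`). Then `h j ^ 2 * |E j - E' j| ≤ 8 T ≤ h j ^ 2 * E' j`,
so `E j ≥ 0`. A union bound over the `k - 1` interior knots concludes. Diagonal dominance also gives
uniqueness of the interpolant, and existence follows by a dimension count. -/

open Set MeasureTheory ProbabilityTheory

noncomputable section

namespace ConvexSpline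

/-! ### Divided differences and the jump system on a mesh with ghost cells. -/

/-- Twice the second divided difference, in terms of cell lengths `h` and first divided
differences `q`. -/
def secondDiff (h q : ℕ → ℝ) (i : ℕ) : ℝ := 2 * (q (i + 1) - q i) / (h i + h (i + 1))

/-- Six times the third divided difference. -/
def thirdDiff (h q : ℕ → ℝ) (i : ℕ) : ℝ :=
  3 * (secondDiff h q (i + 1) - secondDiff h q i) / (h i + h (i + 1) + h (i + 2))

/-- The increments of the third divided differences. -/
def fourthDiff (h q : ℕ → ℝ) (i : ℕ) : ℝ := thirdDiff h q (i + 1) - thirdDiff h q i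

/-- Lower off-diagonal weight of the system for the jumps of the third derivative. -/
def lowerWeight (h : ℕ → ℝ) (i : ℕ) : ℝ :=
  h i ^ 2 / ((h i + h (i + 1)) * (h i + h (i + 1) + h (i + 2)))

/-- Upper off-diagonal weight of the system for the jumps of the third derivative. -/
def upperWeight (h : ℕ → ℝ) (i : ℕ) : ℝ :=
  h (i + 2) ^ 2 / ((h (i + 1) + h (i + 2)) * (h i + h (i + 1) + h (i + 2)))

/-- The tridiagonal operator satisfied by the jumps of the third derivative of a cubic spline. -/
def jumpOp (h E : ℕ → ℝ) (i : ℕ) : ℝ :=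
  lowerWeight h i * E i + (1 - lowerWeight h (i + 1) - upperWeight h i) * E (i + 1) +
    upperWeight h (i + 1) * E (i + 2)

lemma jumpOp_sub (h E E' : ℕ → ℝ) (i : ℕ) :
    jumpOp h (fun j => E j - E' j) i = jumpOp h E i - jumpOp h E' i := by
  simp only [jumpOp]; ring

/-- A mesh of `k` cells, with ghost cells of length zero at both ends, in which cells at distance
at most two have lengths within relative distance `ε`. -/
structure NearUniform (k : ℕ) (h : ℕ → ℝ) (ε : ℝ) : Prop where
  zero : h 0 = 0
  last : h (k + 1) = 0
  pos : ∀ j, 1 ≤ j → j ≤ k → 0 < h j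
  near : ∀ i j, 1 ≤ i → i ≤ k → 1 ≤ j → j ≤ k → i ≤ j + 2 → j ≤ i + 2 → |h i - h j| ≤ ε * h j

lemma NearUniform.nonneg {k : ℕ} {h : ℕ → ℝ} {ε : ℝ} (H : NearUniform k h ε) {j : ℕ}
    (hj : j ≤ k + 1) : 0 ≤ h j := by
  rcases Nat.eq_zero_or_pos j with rfl | h1
  · exact H.zero.ge
  · rcases Nat.lt_or_ge k j with h2 | h2
    · obtain rfl : j = k + 1 := by omega
      exact H.last.ge
    · exact (H.pos j h1 h2).le

/-- In a window of four cells, the outer ones may be ghosts. -/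
lemma NearUniform.window {k : ℕ} {h : ℕ → ℝ} {ε : ℝ} (H : NearUniform k h ε) {i : ℕ}
    (hi : i + 2 ≤ k) : 0 < h (i + 1) ∧ |h (i + 2) - h (i + 1)| ≤ ε * h (i + 1) ∧
      ((h i = 0) ∨ |h i - h (i + 1)| ≤ ε * h (i + 1)) ∧
      ((h (i + 3) = 0) ∨ |h (i + 3) - h (i + 1)| ≤ ε * h (i + 1)) := by
  refine ⟨H.pos _ (by omega) (by omega), H.near _ _ (by omega) (by omega) (by omega) (by omega)
    (by omega) (by omega), ?_, ?_⟩
  · rcases Nat.eq_zero_or_pos i with rfl | h1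
    · exact Or.inl H.zero
    · exact Or.inr (H.near _ _ (by omega) (by omega) (by omega) (by omega) (by omega) (by omega))
  · rcases Nat.lt_or_ge k (i + 3) with h1 | h1
    · obtain rfl : k = i + 2 := by omega
      exact Or.inl H.last
    · exact Or.inr (H.near _ _ (by omega) (by omega) (by omega) (by omega) (by omega) (by omega))

/-- Here `M j` is the second derivative at knot `j` and `s j` the third derivative on cell `j`, so
`s (j + 1) - s j` is the jump at knot `j`. Second differences of `q` are `M` plus a correction in
`s`. Differencing again removes `M` through `hM`, and the last difference leaves only jumps. Row `i`
is centred at knot `i + 1`. The outer cells may have length zero, and the corresponding outer weight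
then vanishes. -/
lemma fourthDiff_eq_jumpOp {h q M s : ℕ → ℝ} {i : ℕ}
    (hq : ∀ j, i ≤ j → j ≤ i + 2 → q (j + 1) - q j = M j * (h j + h (j + 1)) / 2 +
      (s (j + 1) * h (j + 1) ^ 2 - s j * h j ^ 2) / 6)
    (hM : ∀ j, i ≤ j → j ≤ i + 1 → M (j + 1) - M j = s (j + 1) * h (j + 1))
    (h0 : 0 ≤ h i) (h1 : 0 < h (i + 1)) (h2 : 0 < h (i + 2)) (h3 : 0 ≤ h (i + 3)) :
    fourthDiff h q i = jumpOp h (fun j => s (j + 1) - s j) i := by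
  have e0 := hq i le_rfl (by omega)
  have e1 := hq (i + 1) (by omega) (by omega)
  have e2 := hq (i + 2) (by omega) (by omega)
  have m0 := hM i le_rfl (by omega)
  have m1 := hM (i + 1) (by omega) (by omega)
  simp only [fourthDiff, thirdDiff, secondDiff, jumpOp, lowerWeight, upperWeight,
    show i + 1 + 1 = i + 2 from rfl, show i + 1 + 2 = i + 3 from rfl] at *
  rw [e0, e1, e2]
  have M1 : M (i + 1) = M i + s (i + 1) * h (i + 1) := by linarith
  have M2 : M (i + 2) = M i + s (i + 1) * h (i + 1) + s (i + 2) * h (i + 2) := by linarith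
  rw [M1, M2]
  have a1 : h i + h (i + 1) ≠ 0 := by positivity
  have a2 : h (i + 1) + h (i + 2) ≠ 0 := by positivity
  have a3 : h (i + 2) + h (i + 3) ≠ 0 := by positivity
  have a4 : h i + h (i + 1) + h (i + 2) ≠ 0 := by positivity
  have a5 : h (i + 1) + h (i + 2) + h (i + 3) ≠ 0 := by positivity
  generalize h i = x0 at *
  generalize h (i + 1) = x1 at *
  generalize h (i + 2) = x2 at *
  generalize h (i + 3) = x3 at *
  field_simp
  ring

/-- The fourth difference of the cell means of a cubic is its (normalised) leading coefficient. -/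
lemma fourthDiff_cubic {h q x : ℕ → ℝ} {i : ℕ} {c0 c1 c2 c3 : ℝ}
    (hx : ∀ j, i ≤ j → j ≤ i + 3 → x (j + 1) = x j + h j)
    (hq : ∀ j, i ≤ j → j ≤ i + 3 → q j = c0 + c1 * (x j + x (j + 1)) +
      c2 * (x j ^ 2 + x j * x (j + 1) + x (j + 1) ^ 2) +
      c3 * (x j ^ 3 + x j ^ 2 * x (j + 1) + x j * x (j + 1) ^ 2 + x (j + 1) ^ 3))
    (h0 : 0 ≤ h i) (h1 : 0 < h (i + 1)) (h2 : 0 < h (i + 2)) (h3 : 0 ≤ h (i + 3)) :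
    fourthDiff h q i = 6 * c3 * (h i + h (i + 1) + h (i + 2) + h (i + 3)) := by
  have a1 : h i + h (i + 1) ≠ 0 := by positivity
  have a2 : h (i + 1) + h (i + 2) ≠ 0 := by positivity
  have a3 : h (i + 2) + h (i + 3) ≠ 0 := by positivity
  have a4 : h i + h (i + 1) + h (i + 2) ≠ 0 := by positivity
  have a5 : h (i + 1) + h (i + 2) + h (i + 3) ≠ 0 := by positivity
  -- Each divided difference of a power is a complete homogeneous symmetric polynomial in one more
  -- node. Only sums of adjacent lengths are divided by, so coinciding nodes at the ghosts are
  -- harmless.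
  have key : ∀ j, i ≤ j → j ≤ i + 2 → h j + h (j + 1) ≠ 0 → secondDiff h q j = 2 * c1 +
      2 * c2 * (x j + x (j + 1) + x (j + 2)) +
      2 * c3 * (x j ^ 2 + x (j + 1) ^ 2 + x (j + 2) ^ 2 + x j * x (j + 1) + x j * x (j + 2) +
        x (j + 1) * x (j + 2)) := by
    intro j j1 j2 hj
    have e1 := hx j j1 (by omega)
    have e2 := hx (j + 1) (by omega) (by omega)
    rw [secondDiff, hq j j1 (by omega), hq (j + 1) (by omega) (by omega), div_eq_iff hj,
      show j + 2 = j + 1 + 1 from rfl, e2, e1]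
    ring
  have key3 : ∀ j, i ≤ j → j ≤ i + 1 → h j + h (j + 1) ≠ 0 → h (j + 1) + h (j + 2) ≠ 0 →
      h j + h (j + 1) + h (j + 2) ≠ 0 → thirdDiff h q j = 6 * c2 +
      6 * c3 * (x j + x (j + 1) + x (j + 2) + x (j + 3)) := by
    intro j j1 j2 hj hj1 hj2
    have e1 := hx j j1 (by omega)
    have e2 := hx (j + 1) (by omega) (by omega)
    have e3 := hx (j + 2) (by omega) (by omega)
    rw [thirdDiff, key j j1 (by omega) hj, key (j + 1) (by omega) (by omega) hj1, div_eq_iff hj2,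
      show j + 3 = j + 2 + 1 from rfl, show j + 1 + 2 = j + 2 + 1 from rfl,
      show j + 1 + 1 = j + 2 from rfl, e3, show j + 2 = j + 1 + 1 from rfl, e2, e1]
    ring
  have e1 := hx i le_rfl (by omega)
  have e2 := hx (i + 1) (by omega) (by omega)
  have e3 := hx (i + 2) (by omega) (by omega)
  have e4 := hx (i + 3) (by omega) (by omega)
  rw [fourthDiff, key3 i le_rfl (by omega) a1 a2 a4, key3 (i + 1) (by omega) (by omega) a2 a3 a5]
  simp only [show i + 1 + 1 = i + 2 from rfl, show i + 1 + 2 = i + 3 from rfl,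
    show i + 1 + 3 = i + 3 + 1 from rfl] at *
  rw [e4, e3, e2, e1]
  ring

/-- Coefficients depending on the mesh alone let the fourth difference commute with sample means and
with integration against the law. -/
lemma fourthDiff_linear (h : ℕ → ℝ) (i : ℕ) : ∃ c : Fin 4 → ℝ, ∀ q : ℕ → ℝ,
    fourthDiff h q i = ∑ l, c l * q (i + l) := by
  refine ⟨![-(6 / (h i + h (i + 1) + h (i + 2)) / (h i + h (i + 1))),
    6 / (h i + h (i + 1) + h (i + 2)) * ((h i + h (i + 1))⁻¹ + (h (i + 1) + h (i + 2))⁻¹) +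
      6 / (h (i + 1) + h (i + 2) + h (i + 3)) / (h (i + 1) + h (i + 2)),
    -(6 / (h (i + 1) + h (i + 2) + h (i + 3)) *
      ((h (i + 1) + h (i + 2))⁻¹ + (h (i + 2) + h (i + 3))⁻¹)) -
      6 / (h i + h (i + 1) + h (i + 2)) / (h (i + 1) + h (i + 2)),
    6 / (h (i + 1) + h (i + 2) + h (i + 3)) / (h (i + 2) + h (i + 3))], fun q => ?_⟩
  simp only [fourthDiff, thirdDiff, secondDiff, Fin.sum_univ_four, Matrix.cons_val,
    show i + 1 + 1 = i + 2 from rfl, show i + 1 + 2 = i + 3 from rfl, Fin.val_zero, Fin.val_one, Fin.val_two,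
    add_zero, show ((3 : Fin 4) : ℕ) = 3 from rfl]
  ring

/-- This gives locality: an observation outside the window of four cells has constant cell means
there and contributes nothing. -/
lemma fourthDiff_eq_zero_of_const {h q : ℕ → ℝ} {i : ℕ} {c : ℝ}
    (hq : ∀ j, i ≤ j → j ≤ i + 3 → q j = c) : fourthDiff h q i = 0 := by
  simp [fourthDiff, thirdDiff, secondDiff, hq i le_rfl (by omega),
    hq (i + 1) (by omega) (by omega), hq (i + 1 + 1) (by omega) (by omega),
    hq (i + 1 + 1 + 1) (by omega) (by omega)]

/-- The second and third differences each cost one factor `1 / h`. Even with ghosts, two adjacent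
cells in the window contain at least one genuine cell and three contain at least two, whence the
lower bounds 0.99 and 1.98. -/
lemma NearUniform.fourthDiff_bound {k : ℕ} {h q : ℕ → ℝ} {ε Q : ℝ} (H : NearUniform k h ε)
    (hε : ε ≤ 1 / 100) {i : ℕ} (hi : i + 2 ≤ k) (hq : ∀ j, i ≤ j → j ≤ i + 3 → |q j| ≤ Q) :
    h (i + 1) ^ 2 * |fourthDiff h q i| ≤ 40 * Q := by
  obtain ⟨p1, n2, -, -⟩ := H.window hi
  have p0 : 0 ≤ h i := H.nonneg (by omega)
  have p3 : 0 ≤ h (i + 3) := H.nonneg (by omega)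
  have hQ : 0 ≤ Q := (abs_nonneg _).trans (hq i le_rfl (by omega))
  set x := h (i + 1) with hx
  have p2 : 99 / 100 * x ≤ h (i + 2) := by
    have := (abs_le.1 n2).1; nlinarith
  have sec : ∀ j, i ≤ j → j ≤ i + 2 → 99 / 100 * x ≤ h j + h (j + 1) →
      |secondDiff h q j| * x ≤ 400 / 99 * Q := by
    intro j j1 j2 hj
    have b : |2 * (q (j + 1) - q j)| ≤ 4 * Q := by
      have h1 := abs_le.1 (hq j j1 (by omega))
      have h2 := abs_le.1 (hq (j + 1) (by omega) (by omega))
      rw [abs_le]; constructor <;> linarith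
    have pj : 0 < h j + h (j + 1) := by linarith
    rw [secondDiff, abs_div, abs_of_pos pj, div_mul_eq_mul_div, div_le_iff₀ pj]
    calc _ ≤ 4 * Q * x := by gcongr
      _ = 400 / 99 * Q * (99 / 100 * x) := by ring
      _ ≤ _ := by gcongr
  have thi : ∀ j, i ≤ j → j ≤ i + 1 → 99 / 100 * x ≤ h j + h (j + 1) →
      99 / 100 * x ≤ h (j + 1) + h (j + 2) → 198 / 100 * x ≤ h j + h (j + 1) + h (j + 2) →
      |thirdDiff h q j| * x ^ 2 ≤ 20 * Q := by
    intro j j1 j2 hj hj' hj2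
    have b1 := sec j j1 (by omega) hj
    have b2 := sec (j + 1) (by omega) (by omega) hj'
    have pj : 0 < h j + h (j + 1) + h (j + 2) := by linarith
    rw [thirdDiff, abs_div, abs_of_pos pj, div_mul_eq_mul_div, div_le_iff₀ pj]
    have b3 : |3 * (secondDiff h q (j + 1) - secondDiff h q j)| * x ≤ 3 * (800 / 99 * Q) := by
      rw [abs_mul, abs_of_pos (by norm_num : (0 : ℝ) < 3)]
      nlinarith [abs_sub (secondDiff h q (j + 1)) (secondDiff h q j)]
    calc _ = |3 * (secondDiff h q (j + 1) - secondDiff h q j)| * x * x := by ring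
      _ ≤ 3 * (800 / 99 * Q) * x := by gcongr
      _ ≤ 20 * Q * (198 / 100 * x) := by nlinarith [mul_nonneg hQ p1.le]
      _ ≤ _ := by gcongr
  have t1 := thi i le_rfl (by omega) (by linarith) (by linarith) (by linarith)
  have t2 := thi (i + 1) (by omega) (by omega)
    (by simp only [show i + 1 + 1 = i + 2 from rfl]; linarith)
    (by simp only [show i + 1 + 1 = i + 2 from rfl, show i + 1 + 2 = i + 3 from rfl]; linarith)
    (by simp only [show i + 1 + 1 = i + 2 from rfl, show i + 1 + 2 = i + 3 from rfl]; linarith)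
  rw [fourthDiff]
  nlinarith [abs_sub (thirdDiff h q (i + 1)) (thirdDiff h q i), sq_nonneg x]

/-! ### Diagonal dominance of the jump system. -/

/-- The constant 0.521 exceeds 1.01² / 1.98. In use, `c` is 2.97 when the three-cell sum consists of
genuine cells and 1.98 when one of them is a ghost. -/
lemma weight_le {x y S c : ℝ} {z : ℝ} (hz : 0 < z) (hx0 : 0 ≤ x) (hx : x ≤ 101 / 100 * z)
    (hy : 198 / 100 * z ≤ y) (hS : c * z ≤ S) (hc : 0 < c) :
    x ^ 2 / (y * S) ≤ 0.521 / c := by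
  have : 0 < y := by nlinarith
  have : 0 < S := by nlinarith
  rw [div_le_div_iff₀ (by positivity) hc]
  have h1 : x ^ 2 ≤ (101 / 100 * z) ^ 2 := by gcongr
  have h2 : 198 / 100 * z * (c * z) ≤ y * S := by gcongr
  nlinarith [mul_nonneg hc.le (sq_nonneg z)]

lemma sub_le_abs_jumpOp {h E : ℕ → ℝ} {i : ℕ}
    (w0 : 0 ≤ lowerWeight h (i + 1) + upperWeight h i) :
    |E (i + 1)| - (lowerWeight h (i + 1) + upperWeight h i) * |E (i + 1)| -
      |lowerWeight h i * E i| - |upperWeight h (i + 1) * E (i + 2)| ≤ |jumpOp h E i| := by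
  have : E (i + 1) = jumpOp h E i + ((lowerWeight h (i + 1) + upperWeight h i) * E (i + 1)) -
      lowerWeight h i * E i - upperWeight h (i + 1) * E (i + 2) := by
    rw [jumpOp]; ring
  have t2 := abs_sub (jumpOp h E i + ((lowerWeight h (i + 1) + upperWeight h i) * E (i + 1)) -
      lowerWeight h i * E i) (upperWeight h (i + 1) * E (i + 2))
  have t3 := abs_sub (jumpOp h E i + ((lowerWeight h (i + 1) + upperWeight h i) * E (i + 1)))
      (lowerWeight h i * E i)
  have t4 := abs_add_le (jumpOp h E i) ((lowerWeight h (i + 1) + upperWeight h i) * E (i + 1))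
  rw [← this] at t2
  rw [abs_mul (lowerWeight h (i + 1) + upperWeight h i), abs_of_nonneg w0] at t4
  linarith

/-- Diagonal dominance, after scaling by the squares of the cell lengths. -/
lemma NearUniform.abs_mul_sq_le {k : ℕ} {h E : ℕ → ℝ} {ε T : ℝ} (H : NearUniform k h ε)
    (hε : ε ≤ 1 / 100) (hT : ∀ i, i + 2 ≤ k → h (i + 1) ^ 2 * |jumpOp h E i| ≤ T) {j : ℕ}
    (hj1 : 1 ≤ j) (hjk : j + 1 ≤ k) : h j ^ 2 * |E j| ≤ 4 * T := by
  -- Maximum principle: it suffices to bound the scaled unknown at the knot where it is largest,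
  -- since the neighbouring scaled unknowns are then dominated by it.
  obtain ⟨m, hm, hmax⟩ := Finset.exists_max_image (Finset.Icc 1 (k - 1))
    (fun j => h j ^ 2 * |E j|) ⟨1, by simp; omega⟩
  simp only [Finset.mem_Icc] at hm hmax
  refine (hmax j ⟨hj1, by omega⟩).trans ?_
  obtain ⟨i, rfl⟩ : ∃ i, m = i + 1 := ⟨m - 1, by omega⟩
  have hi : i + 2 ≤ k := by omega
  obtain ⟨p1, n2, c0, c3⟩ := H.window hi
  have p0 : 0 ≤ h i := H.nonneg (by omega)
  have p3 : 0 ≤ h (i + 3) := H.nonneg (by omega)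
  have key := hT i hi
  set X := h (i + 1) ^ 2 * |E (i + 1)| with hX
  have hX0 : 0 ≤ X := by positivity
  set x := h (i + 1) with hx
  have l2 : 99 / 100 * x ≤ h (i + 2) := by
    have := (abs_le.1 n2).1; nlinarith
  have u2 : h (i + 2) ≤ 101 / 100 * x := by
    have := (abs_le.1 n2).2; nlinarith
  have e1 : h i = 0 ∨ (h i ^ 2 * |E i| ≤ X ∧ 99 / 100 * x ≤ h i ∧ h i ≤ 101 / 100 * x) := by
    rcases c0 with c0 | c0
    · exact Or.inl c0
    · by_cases hi0 : i = 0
      · left; rw [hi0]; exact H.zero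
      · refine Or.inr ⟨hmax i (by omega), ?_, ?_⟩
        · have := (abs_le.1 c0).1; nlinarith
        · have := (abs_le.1 c0).2; nlinarith
  have e3 : h (i + 3) = 0 ∨ (h (i + 2) ^ 2 * |E (i + 2)| ≤ X ∧ 99 / 100 * x ≤ h (i + 3) ∧
      h (i + 3) ≤ 101 / 100 * x) := by
    rcases c3 with c3 | c3
    · exact Or.inl c3
    · by_cases hi0 : i + 2 = k
      · left; rw [show i + 3 = k + 1 by omega]; exact H.last
      · refine Or.inr ⟨hmax (i + 2) (by omega), ?_, ?_⟩
        · have := (abs_le.1 c3).1; nlinarith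
        · have := (abs_le.1 c3).2; nlinarith
  -- The numerator `h i ^ 2` of the weight is exactly the scaling of `E i`. Both contributions are
  -- at most 0.521 / 2.97 < 0.18. With a ghost the first vanishes and the second is below 0.27.
  have lo : x ^ 2 * |lowerWeight h i * E i| + upperWeight h i * X ≤ 0.36 * X := by
    rcases e1 with e1 | ⟨e1, e1', e1''⟩
    · have : upperWeight h i ≤ 0.521 / 1.98 :=
        weight_le p1 (by linarith) u2 (by linarith) (by linarith) (by norm_num)
      simp only [lowerWeight, e1]
      norm_num at this ⊢
      nlinarith
    · have p2 : 0 < h (i + 2) := by linarith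
      have a1 : upperWeight h i ≤ 0.521 / 2.97 :=
        weight_le p1 (by linarith) u2 (by linarith) (by linarith) (by norm_num)
      have a2 : x ^ 2 / ((h i + h (i + 1)) * (h i + h (i + 1) + h (i + 2))) ≤ 0.521 / 2.97 :=
        weight_le p1 p1.le (by linarith) (by linarith) (by linarith) (by norm_num)
      have : x ^ 2 * |lowerWeight h i * E i| = x ^ 2 / ((h i + h (i + 1)) *
          (h i + h (i + 1) + h (i + 2))) * (h i ^ 2 * |E i|) := by
        rw [abs_mul, abs_of_nonneg (by unfold lowerWeight; positivity), lowerWeight]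
        ring
      rw [this]
      have := mul_le_mul a2 e1 (by positivity) (by norm_num)
      norm_num at a1 this ⊢
      nlinarith
  -- On this side the weight carries `h (i + 3) ^ 2` while `E (i + 2)` is scaled by `h (i + 2) ^ 2`,
  -- so a ratio of neighbouring lengths costs slightly more. The total 0.36 + 0.37 stays below 3/4,
  -- which gives the factor 4.
  have up : x ^ 2 * |upperWeight h (i + 1) * E (i + 2)| + lowerWeight h (i + 1) * X ≤
      0.37 * X := by
    rcases e3 with e1 | ⟨e1, e1', e1''⟩
    · have : lowerWeight h (i + 1) ≤ 0.521 / 1.98 :=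
        weight_le p1 p1.le (by linarith) (by simp only [add_assoc, Nat.reduceAdd]; linarith)
          (by simp only [add_assoc, Nat.reduceAdd]; linarith) (by norm_num)
      simp only [upperWeight, add_assoc, Nat.reduceAdd, e1]
      norm_num at this ⊢
      nlinarith
    · have a1 : lowerWeight h (i + 1) ≤ 0.521 / 2.97 :=
        weight_le p1 p1.le (by linarith) (by simp only [add_assoc, Nat.reduceAdd]; linarith)
          (by simp only [add_assoc, Nat.reduceAdd]; linarith) (by norm_num)
      have a2 : (x * h (i + 3) / h (i + 2)) ^ 2 / ((h (i + 2) + h (i + 3)) *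
          (h (i + 1) + h (i + 2) + h (i + 3))) ≤ 0.19 := by
        have p2 : 0 < h (i + 2) := by linarith
        have b : x * h (i + 3) / h (i + 2) ≤ 102 / 99 * x := by
          rw [div_le_iff₀ p2]; nlinarith
        have b0 : 0 ≤ x * h (i + 3) / h (i + 2) := by positivity
        rw [div_le_iff₀ (by positivity)]
        have : (x * h (i + 3) / h (i + 2)) ^ 2 ≤ (102 / 99 * x) ^ 2 := by gcongr
        have : 198 / 100 * x * (297 / 100 * x) ≤ (h (i + 2) + h (i + 3)) *
          (h (i + 1) + h (i + 2) + h (i + 3)) := by gcongr <;> linarith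
        nlinarith [sq_nonneg x]
      have p2 : 0 < h (i + 2) := by linarith
      have : x ^ 2 * |upperWeight h (i + 1) * E (i + 2)| = (x * h (i + 3) / h (i + 2)) ^ 2 /
          ((h (i + 2) + h (i + 3)) * (h (i + 1) + h (i + 2) + h (i + 3))) *
            (h (i + 2) ^ 2 * |E (i + 2)|) := by
        rw [abs_mul, abs_of_nonneg (by unfold upperWeight; simp only [add_assoc, Nat.reduceAdd];
                                       positivity), upperWeight]
        simp only [add_assoc, Nat.reduceAdd]
        field_simp
      rw [this]
      have := mul_le_mul a2 e1 (by positivity) (by norm_num)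
      norm_num at a1 this ⊢
      nlinarith
  have w0 : 0 ≤ lowerWeight h (i + 1) + upperWeight h i := by
    have : 0 ≤ h (i + 2) := by linarith
    have : 0 ≤ h (i + 1) := p1.le
    unfold lowerWeight upperWeight
    simp only [add_assoc, Nat.reduceAdd]
    positivity
  have t := mul_le_mul_of_nonneg_left (sub_le_abs_jumpOp (E := E) w0) (sq_nonneg x)
  have t' : x ^ 2 * ((lowerWeight h (i + 1) + upperWeight h i) * |E (i + 1)|) =
      (lowerWeight h (i + 1) + upperWeight h i) * X := by rw [hX]; ring
  simp only [mul_sub, t', ← hX] at t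
  linarith

/-! ### The jump operator on slowly varying profiles. -/

/-- Perturbation of the exact value `z² / (2z * cz)` on a uniform mesh: 1/6 for three genuine cells
(`c = 3`), 1/4 when one is a ghost (`c = 2`). -/
lemma abs_weight_sub_le {x y S c ε z : ℝ} (hz : 0 < z) (hε : 0 ≤ ε) (hε' : ε ≤ 1 / 100)
    (hc : 1 ≤ c)
    (hx : |x - z| ≤ ε * z) (hy : |y - 2 * z| ≤ 2 * ε * z) (hS : |S - c * z| ≤ c * ε * z) :
    |x ^ 2 / (y * S) - 1 / (2 * c)| ≤ 4 * ε := by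
  rw [abs_le] at hx hy hS
  have y0 : 0 < y := by nlinarith
  have S0 : 0 < S := by nlinarith [mul_pos (by linarith : 0 < c) hz]
  have c0 : 0 < c := by linarith
  have x0 : 0 ≤ x := by nlinarith
  have yl : (2 * z) * (1 - ε) ≤ y := by linarith
  have yu : y ≤ (2 * z) * (1 + ε) := by linarith
  have Sl : (c * z) * (1 - ε) ≤ S := by linarith
  have Su : S ≤ (c * z) * (1 + ε) := by linarith
  have e1 : 0 ≤ 1 - ε := by linarith
  have L : ((2 * z) * (1 - ε)) * ((c * z) * (1 - ε)) ≤ y * S := by gcongr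
  have U : y * S ≤ ((2 * z) * (1 + ε)) * ((c * z) * (1 + ε)) := by gcongr
  have xl : (z * (1 - ε)) ^ 2 ≤ x ^ 2 := by gcongr; linarith
  have xu : x ^ 2 ≤ (z * (1 + ε)) ^ 2 := by gcongr; linarith
  have hcz : z ^ 2 ≤ c * z ^ 2 := by nlinarith [sq_nonneg z]
  have hz2 : 0 < z ^ 2 := by positivity
  rw [abs_le]
  constructor
  · rw [neg_le_sub_iff_le_add, ← sub_le_iff_le_add, le_div_iff₀ (by positivity)]
    by_cases hs : 0 ≤ 1 / (2 * c) - 4 * ε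
    · calc _ ≤ (1 / (2 * c) - 4 * ε) * (((2 * z) * (1 + ε)) * ((c * z) * (1 + ε))) := by gcongr
        _ = z ^ 2 * (1 + ε) ^ 2 - 8 * ε * (c * z ^ 2) * (1 + ε) ^ 2 := by field_simp; ring
        _ ≤ z ^ 2 * (1 + ε) ^ 2 - 8 * ε * (z ^ 2) * (1 + ε) ^ 2 := by gcongr
        _ ≤ (z * (1 - ε)) ^ 2 := by
          have : (1 + ε) ^ 2 - 8 * ε * (1 + ε) ^ 2 ≤ (1 - ε) ^ 2 := by nlinarith [sq_nonneg ε]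
          nlinarith
        _ ≤ _ := xl
    · push Not at hs
      have := mul_nonneg y0.le S0.le
      nlinarith [sq_nonneg x]
  · rw [sub_le_iff_le_add, div_le_iff₀ (by positivity)]
    calc _ ≤ (z * (1 + ε)) ^ 2 := xu
      _ ≤ z ^ 2 * (1 - ε) ^ 2 + 8 * ε * (z ^ 2) * (1 - ε) ^ 2 := by
          have : (1 + ε) ^ 2 ≤ (1 - ε) ^ 2 + 8 * ε * (1 - ε) ^ 2 := by
            nlinarith [sq_nonneg ε, mul_nonneg hε (by linarith : 0 ≤ 1 - 100 * ε),
              mul_nonneg hε (sq_nonneg ε)]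
          nlinarith
      _ ≤ z ^ 2 * (1 - ε) ^ 2 + 8 * ε * (c * z ^ 2) * (1 - ε) ^ 2 := by gcongr
      _ = (4 * ε + 1 / (2 * c)) * (((2 * z) * (1 - ε)) * ((c * z) * (1 - ε))) := by
          field_simp; ring
      _ ≤ _ := by gcongr

lemma weight_pair_near {x y z ε : ℝ} (hz : 0 < z) (hε : 0 ≤ ε) (hε' : ε ≤ 1 / 100)
    (hy : |y - z| ≤ ε * z) {w : ℝ} (hw : |w - z| ≤ ε * z)
    (hx : x = 0 ∨ |x - z| ≤ ε * z) :
    (x = 0 ∧ |y ^ 2 / ((w + y) * (x + w + y)) - 1 / 4| ≤ 4 * ε) ∨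
    (|x - z| ≤ ε * z ∧ |y ^ 2 / ((w + y) * (x + w + y)) - 1 / 6| ≤ 4 * ε ∧
      |x ^ 2 / ((x + w) * (x + w + y)) - 1 / 6| ≤ 4 * ε) := by
  have hw' := abs_le.1 hw
  have hy2 := abs_le.1 hy
  have n4 : (1 : ℝ) / 4 = 1 / (2 * 2) := by norm_num
  have n6 : (1 : ℝ) / 6 = 1 / (2 * 3) := by norm_num
  rcases hx with hx | hx
  · refine Or.inl ⟨hx, ?_⟩
    rw [n4]
    refine abs_weight_sub_le hz hε hε' (by norm_num) hy ?_ ?_ <;>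
    · rw [abs_le]; constructor <;> linarith
  · have hx2 := abs_le.1 hx
    refine Or.inr ⟨hx, ?_, ?_⟩ <;> rw [n6]
    · refine abs_weight_sub_le hz hε hε' (by norm_num) hy ?_ ?_ <;>
      · rw [abs_le]; constructor <;> linarith
    · refine abs_weight_sub_le hz hε hε' (by norm_num) hx ?_ ?_ <;>
      · rw [abs_le]; constructor <;> linarith

lemma abs_weight_mul_sub_le {v c x z w ε ω B : ℝ} (hz : 0 < z) (hε : 0 ≤ ε) (hε' : ε ≤ 1 / 100)
    (hB : |c| ≤ B) (hv : |v - c| ≤ ω) (hx : |x - z| ≤ ε * z) (hw : |w - 1 / 6| ≤ 4 * ε) :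
    |w * (v * x - c * z)| ≤ (B * ε + ω) * z := by
  have hB0 : 0 ≤ B := (abs_nonneg _).trans hB
  have hω : 0 ≤ ω := (abs_nonneg _).trans hv
  have a1 : |v * x - c * z| ≤ ω * (101 / 100 * z) + B * (ε * z) := by
    rw [show v * x - c * z = (v - c) * x + c * (x - z) by ring]
    refine (abs_add_le _ _).trans ?_
    rw [abs_mul, abs_mul]
    have : |x| ≤ 101 / 100 * z := by
      rw [abs_le] at hx ⊢; constructor <;> nlinarith
    gcongr
  have a2 : |w| ≤ 1 / 2 := by
    rw [abs_le] at hw ⊢; constructor <;> linarith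
  rw [abs_mul]
  have := mul_le_mul a2 a1 (abs_nonneg _) (by norm_num)
  nlinarith [mul_nonneg hω hz.le, mul_nonneg hB0 (mul_nonneg hε hz.le)]

/-- For a genuine outer cell both `z * (l - u)` and `(x - z) / 4` are `O(ε z)`. For a ghost both are
close to `-z / 4`. Thus the imbalance of the weights accounts for the length missing at the
boundary. -/
lemma abs_weight_balance_le {l u x z ε : ℝ} (hz : 0 < z) (hε : 0 ≤ ε)
    (h : (x = 0 ∧ l = 0 ∧ |u - 1 / 4| ≤ 4 * ε) ∨
      (|x - z| ≤ ε * z ∧ |u - 1 / 6| ≤ 4 * ε ∧ |l - 1 / 6| ≤ 4 * ε)) :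
    |z * (l - u) - (x - z) / 4| ≤ 9 * ε * z := by
  have e : 0 ≤ z * ε := by positivity
  rcases h with ⟨rfl, rfl, h⟩ | ⟨hx, h, h'⟩
  · have : z * (0 - u) - (0 - z) / 4 = -(z * (u - 1 / 4)) := by ring
    rw [this, abs_neg, abs_mul, abs_of_pos hz]
    nlinarith
  · have : z * (l - u) - (x - z) / 4 = z * ((l - 1 / 6) - (u - 1 / 6)) - (x - z) / 4 := by ring
    rw [this]
    refine (abs_sub _ _).trans ?_
    rw [abs_mul, abs_of_pos hz, abs_div, abs_of_pos (by norm_num : (0 : ℝ) < 4)]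
    have := abs_sub (l - 1 / 6) (u - 1 / 6)
    nlinarith

/-- A quarter of `v` times the sum of four lengths is the fourth difference of the cell means of a
cubic with third derivative `v` (`fourthDiff_cubic`). So `v j * h j` is the right approximate
solution of the jump system, at the boundary rows as well. -/
lemma NearUniform.abs_sum_sub_jumpOp_le {k : ℕ} {h v : ℕ → ℝ} {ε ω B : ℝ} (H : NearUniform k h ε)
    (hε : 0 ≤ ε) (hε' : ε ≤ 1 / 100) {i : ℕ} (hi : i + 2 ≤ k) (hB : |v (i + 1)| ≤ B)
    (hv : ∀ j, 1 ≤ j → j + 1 ≤ k → i ≤ j → j ≤ i + 2 → |v j - v (i + 1)| ≤ ω) :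
    |v (i + 1) * (h i + h (i + 1) + h (i + 2) + h (i + 3)) / 4 -
      jumpOp h (fun j => v j * h j) i| ≤ (21 * B * ε + 2 * ω) * h (i + 1) := by
  obtain ⟨p1, n2, c0, c3⟩ := H.window hi
  have hω : 0 ≤ ω := (abs_nonneg _).trans (hv (i + 1) (by omega) (by omega) (by omega) (by omega))
  have hB0 : 0 ≤ B := (abs_nonneg _).trans hB
  set z := h (i + 1) with hz
  set c := v (i + 1) with hc
  have n2' := abs_le.1 n2
  have zz : |z - z| ≤ ε * z := by rw [sub_self, abs_zero]; positivity
  -- A ghost has length zero and cannot be within one percent of `z`.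
  have i0 : |h i - z| ≤ ε * z → 1 ≤ i := by
    intro c0
    by_contra hn
    have := H.zero
    rw [show i = 0 by omega, this] at c0
    have := abs_le.1 c0
    nlinarith
  have i3 : |h (i + 3) - z| ≤ ε * z → i + 2 ≠ k := by
    intro c0 hn
    have := H.last
    rw [show i + 3 = k + 1 by omega, this] at c0
    have := abs_le.1 c0
    nlinarith
  have left : |z * (lowerWeight h i - upperWeight h i) - (h i - z) / 4| ≤ 9 * ε * z ∧
      |lowerWeight h i * (v i * h i - c * z)| ≤ (B * ε + ω) * z := by
    rcases weight_pair_near p1 hε hε' n2 zz c0 with ⟨e, u⟩ | ⟨e, u, l⟩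
    · have l : lowerWeight h i = 0 := by simp [lowerWeight, e]
      refine ⟨abs_weight_balance_le p1 hε (Or.inl ⟨e, l, u⟩), ?_⟩
      rw [l, zero_mul, abs_zero]; positivity
    · exact ⟨abs_weight_balance_le p1 hε (Or.inr ⟨e, u, l⟩), abs_weight_mul_sub_le p1 hε hε' hB
        (hv i (i0 e) (by omega) le_rfl (by omega)) e l⟩
  have right : |z * (upperWeight h (i + 1) - lowerWeight h (i + 1)) - (h (i + 3) - z) / 4| ≤
      9 * ε * z ∧
      |upperWeight h (i + 1) * (v (i + 2) * h (i + 2) - c * z)| ≤ (B * ε + ω) * z := by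
    have el : lowerWeight h (i + 1) =
        z ^ 2 / ((h (i + 2) + z) * (h (i + 3) + h (i + 2) + z)) := by
      simp only [lowerWeight, add_assoc, Nat.reduceAdd, hz]
      congr 1; ring
    have eu : upperWeight h (i + 1) =
        h (i + 3) ^ 2 / ((h (i + 3) + h (i + 2)) * (h (i + 3) + h (i + 2) + z)) := by
      simp only [upperWeight, add_assoc, Nat.reduceAdd, hz]
      congr 1; ring
    rw [el, eu]
    rcases weight_pair_near p1 hε hε' zz n2 c3 with ⟨e, u⟩ | ⟨e, u, l⟩
    · have l : h (i + 3) ^ 2 / ((h (i + 3) + h (i + 2)) * (h (i + 3) + h (i + 2) + z)) = 0 := by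
        simp [e]
      refine ⟨abs_weight_balance_le p1 hε (Or.inl ⟨e, l, u⟩), ?_⟩
      rw [l, zero_mul, abs_zero]; positivity
    · have := i3 e
      refine ⟨abs_weight_balance_le p1 hε (Or.inr ⟨e, u, l⟩), ?_⟩
      have b := hv (i + 2) (by omega) (by omega) (by omega) le_rfl
      have l2 := abs_weight_mul_sub_le (x := h (i + 2)) p1 hε hε' hB b n2 l
      exact l2
  set U := lowerWeight h i * (v i * h i - c * z) with hU
  set V := upperWeight h (i + 1) * (v (i + 2) * h (i + 2) - c * z) with hV
  set W := (z * (lowerWeight h i - upperWeight h i) - (h i - z) / 4) +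
        (z * (upperWeight h (i + 1) - lowerWeight h (i + 1)) - (h (i + 3) - z) / 4) -
        (h (i + 2) - z) / 4 with hW
  -- `W` is the error with the coefficient frozen at `c` and the lengths frozen at `z` in the
  -- neighbouring unknowns. `U` and `V` correct for the two neighbours.
  have e : c * (h i + z + h (i + 2) + h (i + 3)) / 4 - jumpOp h (fun j => v j * h j) i =
      -(c * W) - U - V := by
    simp only [jumpOp, ← hz, ← hc, hU, hV, hW]; ring
  have w : |W| ≤ 19 * ε * z := by
    have l := abs_le.1 left.1
    have r := abs_le.1 right.1
    have : 0 ≤ ε * z := by positivity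
    rw [hW, abs_le]; constructor <;> linarith
  have cw : |c * W| ≤ B * (19 * ε * z) := by
    rw [abs_mul]; exact mul_le_mul hB w (abs_nonneg _) hB0
  rw [e]
  have u1 := abs_le.1 left.2
  have u2 := abs_le.1 right.2
  have u3 := abs_le.1 cw
  rw [abs_le]
  constructor <;> linarith [u1.1, u1.2, u2.1, u2.2, u3.1, u3.2]

/-- If the data of a spline are close to a profile with sufficiently positive jumps, then the
jumps of the spline are nonnegative. -/
lemma NearUniform.nonneg_of_close {k : ℕ} {h q q' E E' : ℕ → ℝ} {ε T : ℝ} (H : NearUniform k h ε)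
    (hε : ε ≤ 1 / 100) (hE : ∀ i, i + 2 ≤ k → jumpOp h E i = fourthDiff h q i)
    (hr : ∀ i, i + 2 ≤ k → h (i + 1) ^ 2 * |fourthDiff h q' i - jumpOp h E' i| ≤ T)
    (hn : ∀ i, i + 2 ≤ k → h (i + 1) ^ 2 * |fourthDiff h q i - fourthDiff h q' i| ≤ T)
    {j : ℕ} (hj1 : 1 ≤ j) (hjk : j + 1 ≤ k) (hE' : 8 * T ≤ h j ^ 2 * E' j) : 0 ≤ E j := by
  -- Residual and noise together perturb the right-hand side by at most `2 * T`, which the inverse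
  -- enlarges to `8 * T`.
  have key := H.abs_mul_sq_le hε (E := fun j => E j - E' j) (T := 2 * T) (by
    intro i hi
    rw [jumpOp_sub, hE i hi]
    have t := abs_sub_le (fourthDiff h q i) (fourthDiff h q' i) (jumpOp h E' i)
    have := mul_le_mul_of_nonneg_left t (sq_nonneg (h (i + 1)))
    linarith [hr i hi, hn i hi]) hj1 hjk
  have pj : 0 < h j ^ 2 := pow_pos (H.pos j hj1 (by omega)) 2
  have := neg_abs_le (E j - E' j)
  nlinarith

/-! ### Complete cubic splines: pieces, jumps and convexity. -/

/-- Lengths of the cells of a mesh, with ghost cells of length zero at both ends. -/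
def gap (k : ℕ) (a : ℕ → ℝ) (i : ℕ) : ℝ := a (min i k) - a (i - 1)

/-- Truncated subtraction `0 - 1 = 0` creates the left ghost. The minimum with `k` creates the right
one. -/
lemma gap_zero (k : ℕ) (a : ℕ → ℝ) : gap k a 0 = 0 := by simp [gap]

lemma gap_last (k : ℕ) (a : ℕ → ℝ) : gap k a (k + 1) = 0 := by simp [gap]

lemma gap_succ {k j : ℕ} (a : ℕ → ℝ) (hj : j < k) : gap k a (j + 1) = a (j + 1) - a j := by
  simp [gap, Nat.min_eq_left (Nat.succ_le_of_lt hj)]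

/-- First divided differences, with the derivative at the two end knots. -/
def dividedDiff (k : ℕ) (a : ℕ → ℝ) (g g' : ℝ → ℝ) (i : ℕ) : ℝ :=
  if i = 0 then g' (a 0) else if i ≤ k then (g (a i) - g (a (i - 1))) / gap k a i else g' (a k)

/-- At the knot itself the function is `O(|x - a| ^ (n + 2))` with exponent above 1, so its
derivative is zero there. -/
lemma hasDerivAt_max_pow (a : ℝ) (n : ℕ) (t : ℝ) :
    HasDerivAt (fun t => max (t - a) 0 ^ (n + 2)) ((n + 2) * max (t - a) 0 ^ (n + 1)) t := by
  rcases lt_trichotomy t a with h | h | h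
  · have : (fun t => max (t - a) 0 ^ (n + 2)) =ᶠ[nhds t] fun _ => (0 : ℝ) := by
      filter_upwards [Iio_mem_nhds h] with x hx
      simp [max_eq_right (sub_nonpos.2 (mem_Iio.1 hx).le)]
    rw [max_eq_right (sub_nonpos.2 h.le)]
    simpa using (hasDerivAt_const t (0 : ℝ)).congr_of_eventuallyEq this
  · subst h
    have : (fun x => max (x - t) 0 ^ (n + 2)) =O[nhds t] fun x => ‖x - t‖ ^ (n + 2) := by
      refine Asymptotics.IsBigO.of_bound 1 (Filter.Eventually.of_forall fun x => ?_)
      rw [norm_pow, norm_pow, one_mul, norm_norm]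
      gcongr
      rw [Real.norm_eq_abs, Real.norm_eq_abs, abs_of_nonneg (le_max_right _ _)]
      exact max_le (le_abs_self _) (abs_nonneg _)
    have := (this.hasFDerivAt (𝕜 := ℝ) (by omega)).hasDerivAt
    simpa using this
  · have : (fun t => max (t - a) 0 ^ (n + 2)) =ᶠ[nhds t] fun t => (t - a) ^ (n + 2) := by
      filter_upwards [Ioi_mem_nhds h] with x hx
      rw [max_eq_left (sub_nonneg.2 (mem_Ioi.1 hx).le)]
    rw [max_eq_left (sub_nonneg.2 h.le)]
    have h2 := ((hasDerivAt_id t).sub_const a).pow (n + 2)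
    refine HasDerivAt.congr_of_eventuallyEq ?_ this
    refine h2.congr_deriv ?_
    simp

lemma exists_cell {k : ℕ} {a : ℕ → ℝ} {x : ℝ} (hk : 0 < k) (hx : x ∈ Icc (a 0) (a k)) :
    ∃ j < k, x ∈ Icc (a j) (a (j + 1)) := by
  induction k with
  | zero => omega
  | succ n ih =>
    rcases Nat.eq_zero_or_pos n with rfl | hn
    · exact ⟨0, by omega, hx⟩
    · rcases le_total x (a n) with h | h
      · obtain ⟨j, hj, hj'⟩ := ih hn ⟨hx.1, h⟩
        exact ⟨j, by omega, hj'⟩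
      · exact ⟨n, by omega, h, hx.2⟩

lemma mesh_strictMono {k : ℕ} {a : ℕ → ℝ} (ha : ∀ j < k, a j < a (j + 1)) {i j : ℕ} (hij : i < j)
    (hj : j ≤ k) : a i < a j := by
  induction j with
  | zero => omega
  | succ n ih =>
    rcases Nat.lt_or_ge i n with h | h
    · exact (ih h (by omega)).trans (ha n (by omega))
    · rw [show i = n by omega]
      exact ha n (by omega)

lemma mesh_mono {k : ℕ} {a : ℕ → ℝ} (ha : ∀ j < k, a j < a (j + 1)) {i j : ℕ} (hij : i ≤ j)
    (hj : j ≤ k) : a i ≤ a j := by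
  rcases hij.eq_or_lt with rfl | h
  · exact le_rfl
  · exact (mesh_strictMono ha h hj).le

lemma exists_cubic_expansion {p : Polynomial ℝ} (hp : p.natDegree ≤ 3) (y : ℝ) :
    ∃ c0 c1 c2 c3 : ℝ, ∀ x, p.eval x =
      c0 + c1 * (x - y) + c2 / 2 * (x - y) ^ 2 + c3 / 6 * (x - y) ^ 3 := by
  refine ⟨p.coeff 0 + p.coeff 1 * y + p.coeff 2 * y ^ 2 + p.coeff 3 * y ^ 3,
    p.coeff 1 + 2 * p.coeff 2 * y + 3 * p.coeff 3 * y ^ 2, 2 * p.coeff 2 + 6 * p.coeff 3 * y,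
    6 * p.coeff 3, fun x => ?_⟩
  rw [Polynomial.eval_eq_sum_range' (Nat.lt_succ_of_le hp)]
  simp only [Finset.sum_range_succ, Finset.sum_range_zero]
  ring

/-- Equality holds in the open cell and passes to its ends by continuity of both sides. The
derivative is taken within the whole interval, so adjacent cells share its value at their common
knot. -/
lemma derivWithin_eq_of_cell {H P P' : ℝ → ℝ} {A B c d : ℝ} (hcd : c < d)
    (hsub : Icc c d ⊆ Icc A B)
    (hc : ContinuousOn (derivWithin H (Icc A B)) (Icc A B)) (hP : ∀ x, HasDerivAt P (P' x) x)
    (hP' : Continuous P') (heq : EqOn H P (Icc c d)) :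
    EqOn (derivWithin H (Icc A B)) P' (Icc c d) := by
  have h1 : EqOn (derivWithin H (Icc A B)) P' (Ioo c d) := by
    intro x hx
    have hn : Icc A B ∈ nhds x :=
      Filter.mem_of_superset (Icc_mem_nhds hx.1 hx.2) hsub
    rw [derivWithin_of_mem_nhds hn]
    refine HasDerivAt.deriv ((hP x).congr_of_eventuallyEq ?_)
    filter_upwards [Icc_mem_nhds hx.1 hx.2] with y hy using heq hy
  exact h1.of_subset_closure (hc.mono hsub) hP'.continuousOn Ioo_subset_Icc_self
    (by rw [closure_Ioo hcd.ne])

/-- Pieces of a complete cubic spline: slopes `b` and second derivatives `M` at the knots, third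
derivatives `s (j + 1)` on the cells. -/
lemma IsCompleteCubicSpline.exists_pieces {k : ℕ} {a : ℕ → ℝ} {g g' H : ℝ → ℝ} (hk : 0 < k)
    (ha : ∀ j < k, a j < a (j + 1)) (hH : IsCompleteCubicSpline k a g g' H) :
    ∃ b M s : ℕ → ℝ, b 0 = g' (a 0) ∧ b k = g' (a k) ∧ ∀ j < k,
      g (a (j + 1)) = g (a j) + b j * gap k a (j + 1) + M j / 2 * gap k a (j + 1) ^ 2 +
        s (j + 1) / 6 * gap k a (j + 1) ^ 3 ∧
      b (j + 1) = b j + M j * gap k a (j + 1) + s (j + 1) / 2 * gap k a (j + 1) ^ 2 ∧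
      M (j + 1) = M j + s (j + 1) * gap k a (j + 1) ∧
      ∀ x ∈ Icc (a j) (a (j + 1)),
        iteratedDerivWithin 2 H (Icc (a 0) (a k)) x = M j + s (j + 1) * (x - a j) := by
  set S := Icc (a 0) (a k) with hS
  have h0k : a 0 < a k := mesh_strictMono ha hk le_rfl
  have hu : UniqueDiffOn ℝ S := uniqueDiffOn_Icc h0k
  have hsub : ∀ j < k, Icc (a j) (a (j + 1)) ⊆ S := fun j hj =>
    Icc_subset_Icc (mesh_mono ha (Nat.zero_le j) hj.le) (mesh_mono ha hj le_rfl)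
  have c1 : ContDiffOn ℝ 1 (derivWithin H S) S := hH.contDiffOn.derivWithin hu (by norm_num)
  have c2 : ContinuousOn (derivWithin (derivWithin H S) S) S :=
    (c1.derivWithin (m := 0) hu (by norm_num)).continuousOn
  have i2 : ∀ x, iteratedDerivWithin 2 H S x = derivWithin (derivWithin H S) S x := by
    intro x
    rw [iteratedDerivWithin_succ, iteratedDerivWithin_one]
  have pieces : ∀ j, ∃ c1 c2 c3 : ℝ, j < k →
      (∀ x ∈ Icc (a j) (a (j + 1)), H x = g (a j) + c1 * (x - a j) + c2 / 2 * (x - a j) ^ 2 +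
        c3 / 6 * (x - a j) ^ 3) ∧
      (∀ x ∈ Icc (a j) (a (j + 1)), derivWithin H S x = c1 + c2 * (x - a j) +
        c3 / 2 * (x - a j) ^ 2) ∧
      (∀ x ∈ Icc (a j) (a (j + 1)), iteratedDerivWithin 2 H S x = c2 + c3 * (x - a j)) := by
    intro j
    by_cases hj : j < k
    · obtain ⟨p, hp, hpe⟩ := hH.cubic j hj
      obtain ⟨d0, d1, d2, d3, hd⟩ := exists_cubic_expansion hp (a j)
      have e0 : EqOn H (fun x => d0 + d1 * (x - a j) + d2 / 2 * (x - a j) ^ 2 +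
          d3 / 6 * (x - a j) ^ 3) (Icc (a j) (a (j + 1))) := fun x hx => by
        rw [hpe x hx, hd]
      have e1 := derivWithin_eq_of_cell (P' := fun x => d1 + d2 * (x - a j) +
          d3 / 2 * (x - a j) ^ 2) (ha j hj) (hsub j hj) c1.continuousOn (fun x => by
        have := ((hasDerivAt_id x).sub_const (a j))
        have := (((this.const_mul d1).const_add d0).add ((this.pow 2).const_mul (d2 / 2))).add
          ((this.pow 3).const_mul (d3 / 6))
        refine this.congr_deriv ?_
        simp
        ring) (by fun_prop) e0
      have e2 := derivWithin_eq_of_cell (P' := fun x => d2 + d3 * (x - a j))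
          (ha j hj) (hsub j hj) c2 (fun x => by
        have := ((hasDerivAt_id x).sub_const (a j))
        have := ((this.const_mul d2).const_add d1).add ((this.pow 2).const_mul (d3 / 2))
        refine this.congr_deriv ?_
        simp
        ring) (by fun_prop) e1
      have hd0 : g (a j) = d0 := by
        rw [← hH.interpolates j hj.le, e0 (left_mem_Icc.2 (ha j hj).le)]
        simp
      refine ⟨d1, d2, d3, fun _ => ⟨fun x hx => ?_, fun x hx => e1 hx, fun x hx => ?_⟩⟩
      · rw [hd0]; exact e0 hx
      · rw [i2]; exact e2 hx
    · exact ⟨0, 0, 0, fun h => absurd h hj⟩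
  choose C1 C2 C3 hC using pieces
  -- Slopes and second derivatives are read off from `H` itself, so the `C²` matching is automatic.
  -- The shift `j - 1` numbers third derivatives by cells, starting at 1.
  refine ⟨fun j => derivWithin H S (a j), fun j => iteratedDerivWithin 2 H S (a j),
    fun j => C3 (j - 1), hH.deriv_left, hH.deriv_right, fun j hj => ?_⟩
  obtain ⟨r0, r1, r2⟩ := hC j hj
  have hl := left_mem_Icc.2 (ha j hj).le
  have hr := right_mem_Icc.2 (ha j hj).le
  have v1 := r1 _ hl
  have v2 := r2 _ hl
  simp only [sub_self, mul_zero, add_zero, ne_eq, OfNat.ofNat_ne_zero, not_false_eq_true,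
    zero_pow] at v1 v2
  simp only [v1, v2, gap_succ a hj, Nat.add_sub_cancel]
  refine ⟨?_, r1 _ hr, r2 _ hr, r2⟩
  rw [← hH.interpolates (j + 1) hj, r0 _ hr]

/-- The jumps of the third derivative of a complete cubic spline satisfy the tridiagonal system,
and its second derivative is determined by them. -/
lemma IsCompleteCubicSpline.exists_jumps {k : ℕ} {a : ℕ → ℝ} {g g' H : ℝ → ℝ} (hk : 0 < k)
    (ha : ∀ j < k, a j < a (j + 1)) (hH : IsCompleteCubicSpline k a g g' H) :
    ∃ M s : ℕ → ℝ,
      (∀ j ≤ k, dividedDiff k a g g' (j + 1) - dividedDiff k a g g' j =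
        M j * (gap k a j + gap k a (j + 1)) / 2 +
          (s (j + 1) * gap k a (j + 1) ^ 2 - s j * gap k a j ^ 2) / 6) ∧
      (∀ j < k, M (j + 1) - M j = s (j + 1) * gap k a (j + 1)) ∧
      (∀ j < k, ∀ x ∈ Icc (a j) (a (j + 1)),
        iteratedDerivWithin 2 H (Icc (a 0) (a k)) x = M j + s (j + 1) * (x - a j)) := by
  obtain ⟨b, M, s, hb0, hbk, hp⟩ := hH.exists_pieces hk ha
  refine ⟨M, s, ?_, fun j hj => ?_, fun j hj => (hp j hj).2.2.2⟩
  · have gp : ∀ j < k, 0 < gap k a (j + 1) := fun j hj => by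
      rw [gap_succ a hj]; exact sub_pos.2 (ha j hj)
    -- The same divided difference is expanded about the left knot of its cell (`right`) and about
    -- the right knot (`left`). Subtraction at a common knot cancels the slope. At a ghost both
    -- formulas reduce to the prescribed end slope.
    have right : ∀ j ≤ k, dividedDiff k a g g' (j + 1) = b j + M j / 2 * gap k a (j + 1) +
        s (j + 1) / 6 * gap k a (j + 1) ^ 2 := by
      intro j hj
      rcases hj.lt_or_eq with hj | rfl
      · have := (gp j hj).ne'
        rw [dividedDiff, if_neg (by omega), if_pos (by omega), Nat.add_sub_cancel, (hp j hj).1]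
        field_simp
        ring
      · rw [dividedDiff, if_neg (by omega), if_neg (by omega), gap_last, hbk]
        simp
    have left : ∀ j ≤ k, dividedDiff k a g g' j = b j - M j / 2 * gap k a j +
        s j / 6 * gap k a j ^ 2 := by
      intro j hj
      rcases Nat.eq_zero_or_pos j with rfl | h1
      · rw [dividedDiff, if_pos rfl, gap_zero, hb0]
        simp
      · obtain ⟨i, rfl⟩ : ∃ i, j = i + 1 := ⟨j - 1, by omega⟩
        rw [right i (by omega), (hp i hj).2.1, (hp i hj).2.2.1]
        ring
    intro j hj
    rw [right j hj, left j hj]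
    ring
  · rw [(hp j hj).2.2.1]; ring

lemma gap_pos {k : ℕ} {a : ℕ → ℝ} (ha : ∀ j < k, a j < a (j + 1)) {j : ℕ} (h1 : 1 ≤ j)
    (h2 : j ≤ k) : 0 < gap k a j := by
  obtain ⟨i, rfl⟩ : ∃ i, j = i + 1 := ⟨j - 1, by omega⟩
  rw [gap_succ a h2]
  exact sub_pos.2 (ha i h2)

lemma gap_nonneg {k : ℕ} {a : ℕ → ℝ} (ha : ∀ j < k, a j < a (j + 1)) {j : ℕ}
    (h2 : j ≤ k + 1) : 0 ≤ gap k a j := by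
  rcases Nat.eq_zero_or_pos j with rfl | h1
  · rw [gap_zero]
  · rcases Nat.lt_or_ge k j with h | h
    · rw [show j = k + 1 by omega, gap_last]
    · exact (gap_pos ha h1 h).le

lemma fourthDiff_eq_jumpOp_of_spline {k : ℕ} {a q M s : ℕ → ℝ}
    (ha : ∀ j < k, a j < a (j + 1))
    (hq : ∀ j ≤ k, q (j + 1) - q j = M j * (gap k a j + gap k a (j + 1)) / 2 +
          (s (j + 1) * gap k a (j + 1) ^ 2 - s j * gap k a j ^ 2) / 6)
    (hM : ∀ j < k, M (j + 1) - M j = s (j + 1) * gap k a (j + 1)) {i : ℕ} (hi : i + 2 ≤ k) :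
    jumpOp (gap k a) (fun j => s (j + 1) - s j) i = fourthDiff (gap k a) q i :=
  (fourthDiff_eq_jumpOp (fun j _ h => hq j (by omega)) (fun j _ h => hM j (by omega))
    (gap_nonneg ha (by omega)) (gap_pos ha (by omega) (by omega))
    (gap_pos ha (by omega) (by omega)) (gap_nonneg ha (by omega))).symm

/-- A continuous piecewise affine function with increasing slopes is convex. -/
lemma convexOn_of_affine_pieces {k : ℕ} {a M s : ℕ → ℝ} {H2 : ℝ → ℝ} (hk : 0 < k)
    (ha : ∀ j < k, a j < a (j + 1))
    (hM : ∀ j < k, M (j + 1) - M j = s (j + 1) * gap k a (j + 1))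
    (hs : ∀ j, 1 ≤ j → j + 1 ≤ k → 0 ≤ s (j + 1) - s j)
    (h2 : ∀ j < k, ∀ x ∈ Icc (a j) (a (j + 1)), H2 x = M j + s (j + 1) * (x - a j)) :
    ConvexOn ℝ (Icc (a 0) (a k)) H2 := by
  have partial_sum : ∀ m < k, ∀ x, M m + s (m + 1) * (x - a m) = M 0 + s 1 * (x - a 0) +
      ∑ j ∈ Finset.Ico 1 (m + 1), (s (j + 1) - s j) * (x - a j) := by
    intro m
    induction m with
    | zero => intro _ x; simp
    | succ n ih =>
      intro hn x
      have e := ih (by omega) x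
      have m1 := hM n (by omega)
      rw [gap_succ a (by omega)] at m1
      rw [Finset.sum_Ico_succ_top (by omega), ← add_assoc, ← e]
      linear_combination m1
  -- An affine function plus nonnegative multiples of the convex hinges `max (x - a j) 0`.
  have rep : EqOn (fun x => M 0 + s 1 * (x - a 0) +
      ∑ j ∈ Finset.Ico 1 k, (s (j + 1) - s j) * max (x - a j) 0) H2 (Icc (a 0) (a k)) := by
    intro x hx
    obtain ⟨m, hm, hxm⟩ := exists_cell hk hx
    simp only
    rw [h2 m hm x hxm, partial_sum m hm x, ← Finset.sum_Ico_consecutive _ (show 1 ≤ m + 1 by omega)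
      (show m + 1 ≤ k by omega)]
    have z1 : ∑ j ∈ Finset.Ico (m + 1) k, (s (j + 1) - s j) * max (x - a j) 0 = 0 := by
      refine Finset.sum_eq_zero fun j hj => ?_
      rw [Finset.mem_Ico] at hj
      rw [max_eq_right, mul_zero]
      linarith [hxm.2, mesh_mono ha hj.1 hj.2.le]
    rw [z1, add_zero]
    congr 1
    refine Finset.sum_congr rfl fun j hj => ?_
    rw [Finset.mem_Ico] at hj
    rw [max_eq_left]
    linarith [hxm.1, mesh_mono ha (show j ≤ m by omega) hm.le]
  refine ConvexOn.congr ?_ rep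
  refine ConvexOn.add ?_ ?_
  · have : (fun x => M 0 + s 1 * (x - a 0)) = fun x => s 1 * x + (M 0 - s 1 * a 0) := by
      ext x; ring
    rw [this]
    exact ((LinearMap.mul ℝ ℝ (s 1)).convexOn (convex_Icc _ _)).add_const _
  · have : ∀ t : Finset ℕ, t ⊆ Finset.Ico 1 k → ConvexOn ℝ (Icc (a 0) (a k))
        (fun x => ∑ j ∈ t, (s (j + 1) - s j) * max (x - a j) 0) := by
      intro t
      induction t using Finset.induction_on with
      | empty => intro _; simpa using convexOn_const (0 : ℝ) (convex_Icc (a 0) (a k))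
      | insert j t hj ih =>
        intro ht
        simp only [Finset.sum_insert hj]
        refine ConvexOn.add ?_ (ih fun i hi => ht (Finset.mem_insert_of_mem hi))
        have hj' := Finset.mem_Ico.1 (ht (Finset.mem_insert_self j t))
        have c : ConvexOn ℝ (Icc (a 0) (a k)) (fun x => max (x - a j) 0) :=
          ((convexOn_id (convex_Icc _ _)).sub (concaveOn_const _ (convex_Icc _ _))).sup
            (convexOn_const _ (convex_Icc _ _))
        exact c.smul (hs j hj'.1 hj'.2)
    exact this _ subset_rfl

/-! ### Existence of the interpolant through the truncated power basis. -/

section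

/-- Cubic splines with simple interior knots `a 1, …, a n`, in the truncated power basis. -/
def truncSpline {n : ℕ} (a : ℕ → ℝ) (c : Fin 4 → ℝ) (d : Fin n → ℝ) (t : ℝ) : ℝ :=
  c 0 + c 1 * (t - a 0) + c 2 * (t - a 0) ^ 2 + c 3 * (t - a 0) ^ 3 +
    ∑ l, d l * max (t - a (l + 1)) 0 ^ 3

/-- The derivative of `truncSpline`. -/
def truncSplineDeriv {n : ℕ} (a : ℕ → ℝ) (c : Fin 4 → ℝ) (d : Fin n → ℝ) (t : ℝ) : ℝ :=
  c 1 + 2 * c 2 * (t - a 0) + 3 * c 3 * (t - a 0) ^ 2 +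
    ∑ l, d l * (3 * max (t - a (l + 1)) 0 ^ 2)

/-- The second derivative of `truncSpline`. -/
def truncSplineDeriv2 {n : ℕ} (a : ℕ → ℝ) (c : Fin 4 → ℝ) (d : Fin n → ℝ) (t : ℝ) : ℝ :=
  2 * c 2 + 6 * c 3 * (t - a 0) + ∑ l, d l * (6 * max (t - a (l + 1)) 0)

variable {n : ℕ} (a : ℕ → ℝ) (c : Fin 4 → ℝ) (d : Fin n → ℝ)

lemma hasDerivAt_truncSpline (t : ℝ) :
    HasDerivAt (truncSpline a c d) (truncSplineDeriv a c d t) t := by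
  have h := (hasDerivAt_id t).sub_const (a 0)
  have h1 := (((h.const_mul (c 1)).const_add (c 0)).add ((h.pow 2).const_mul (c 2))).add
    ((h.pow 3).const_mul (c 3))
  have h2 := HasDerivAt.fun_sum (u := Finset.univ) fun (l : Fin n) _ =>
    (hasDerivAt_max_pow (a (l + 1)) 1 t).const_mul (d l)
  refine (h1.add h2).congr_deriv ?_
  simp only [truncSplineDeriv, id]
  norm_num
  ring

lemma hasDerivAt_truncSplineDeriv (t : ℝ) :
    HasDerivAt (truncSplineDeriv a c d) (truncSplineDeriv2 a c d t) t := by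
  have h := (hasDerivAt_id t).sub_const (a 0)
  have h1 := (((h.const_mul (2 * c 2)).const_add (c 1)).add ((h.pow 2).const_mul (3 * c 3)))
  have h2 := HasDerivAt.fun_sum (u := Finset.univ) fun (l : Fin n) _ =>
    ((hasDerivAt_max_pow (a (l + 1)) 0 t).const_mul 3).const_mul (d l)
  refine (h1.add h2).congr_deriv ?_
  simp only [truncSplineDeriv2, id]
  norm_num
  ring_nf

lemma contDiff_truncSpline : ContDiff ℝ 2 (truncSpline a c d) := by
  have d1 : deriv (truncSpline a c d) = truncSplineDeriv a c d :=
    funext fun t => (hasDerivAt_truncSpline a c d t).deriv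
  have d2 : deriv (truncSplineDeriv a c d) = truncSplineDeriv2 a c d :=
    funext fun t => (hasDerivAt_truncSplineDeriv a c d t).deriv
  rw [show (2 : WithTop ℕ∞) = 1 + 1 by norm_num, contDiff_succ_iff_deriv]
  refine ⟨fun t => (hasDerivAt_truncSpline a c d t).differentiableAt, by simp, ?_⟩
  rw [d1, show (1 : WithTop ℕ∞) = 0 + 1 by norm_num, contDiff_succ_iff_deriv]
  refine ⟨fun t => (hasDerivAt_truncSplineDeriv a c d t).differentiableAt, by simp, ?_⟩
  rw [d2, contDiff_zero]
  unfold truncSplineDeriv2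
  fun_prop

variable {a}

lemma isCompleteCubicSpline_truncSpline (ha : ∀ j < n + 1, a j < a (j + 1)) {g g' : ℝ → ℝ}
    (hg : ∀ j ≤ n + 1, truncSpline a c d (a j) = g (a j))
    (hl : truncSplineDeriv a c d (a 0) = g' (a 0))
    (hr : truncSplineDeriv a c d (a (n + 1)) = g' (a (n + 1))) :
    IsCompleteCubicSpline (n + 1) a g g' (truncSpline a c d) := by
  have h0k : a 0 < a (n + 1) := mesh_strictMono ha (Nat.succ_pos n) le_rfl
  have hd : ∀ t ∈ Icc (a 0) (a (n + 1)), derivWithin (truncSpline a c d)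
      (Icc (a 0) (a (n + 1))) t = truncSplineDeriv a c d t := fun t ht =>
    (hasDerivAt_truncSpline a c d t).hasDerivWithinAt.derivWithin (uniqueDiffOn_Icc h0k t ht)
  refine ⟨(contDiff_truncSpline a c d).contDiffOn, fun j hj => ?_, hg, ?_, ?_⟩
  · open Polynomial in
    refine ⟨C (c 0) + C (c 1) * (X - C (a 0)) + C (c 2) * (X - C (a 0)) ^ 2 +
      C (c 3) * (X - C (a 0)) ^ 3 + ∑ l : Fin n, if (l : ℕ) + 1 ≤ j then
        C (d l) * (X - C (a (l + 1))) ^ 3 else 0, ?_, fun x hx => ?_⟩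
    · have p : ∀ (m : ℕ) (y z : ℝ), m ≤ 3 → (C z * (X - C y) ^ m : ℝ[X]).natDegree ≤ 3 := by
        intro m y z hm
        refine natDegree_C_mul_le _ _ |>.trans ?_
        refine natDegree_pow_le.trans ?_
        rw [natDegree_X_sub_C, mul_one]
        exact hm
      refine natDegree_add_le_of_degree_le (natDegree_add_le_of_degree_le
        (natDegree_add_le_of_degree_le (natDegree_add_le_of_degree_le ?_ ?_) ?_) ?_) ?_
      · simp
      · simpa using p 1 (a 0) (c 1) (by norm_num)
      · exact p 2 _ _ (by norm_num)
      · exact p 3 _ _ le_rfl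
      · refine natDegree_sum_le_of_forall_le _ _ fun l _ => ?_
        split_ifs
        · exact p 3 _ _ le_rfl
        · simp
    · rw [truncSpline]
      simp only [eval_add, eval_mul, eval_C, eval_sub, eval_X, eval_pow, eval_finsetSum]
      congr 1
      refine Finset.sum_congr rfl fun l _ => ?_
      split_ifs with hl
      · rw [max_eq_left]
        · simp
        · linarith [hx.1, mesh_mono ha hl hj.le]
      · rw [max_eq_right]
        · simp
        · linarith [hx.2, mesh_mono ha (show j + 1 ≤ l + 1 by omega)
            (show (l : ℕ) + 1 ≤ n + 1 by omega)]
  · rw [hd _ (left_mem_Icc.2 h0k.le), hl]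
  · rw [hd _ (right_mem_Icc.2 h0k.le), hr]

lemma iteratedDerivWithin_truncSpline {A B t : ℝ} (hAB : A < B) (ht : t ∈ Icc A B) :
    iteratedDerivWithin 2 (truncSpline a c d) (Icc A B) t = truncSplineDeriv2 a c d t := by
  have hu := uniqueDiffOn_Icc hAB
  rw [iteratedDerivWithin_succ, iteratedDerivWithin_one]
  have : EqOn (derivWithin (truncSpline a c d) (Icc A B)) (truncSplineDeriv a c d) (Icc A B) :=
    fun t ht => (hasDerivAt_truncSpline a c d t).hasDerivWithinAt.derivWithin (hu t ht)
  rw [derivWithin_congr this (this ht)]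
  exact (hasDerivAt_truncSplineDeriv a c d t).hasDerivWithinAt.derivWithin (hu t ht)

/-- The system is triangular: the value at `a 0` determines `c 2`, that at `a 1` determines `c 3`,
and that at `a (m + 2)` determines `d m` once the earlier ones vanish. -/
lemma truncSplineDeriv2_eq_zero_iff (ha : ∀ j < n + 1, a j < a (j + 1))
    (h : ∀ j ≤ n + 1, truncSplineDeriv2 a c d (a j) = 0) : c 2 = 0 ∧ c 3 = 0 ∧ d = 0 := by
  have c2 : c 2 = 0 := by
    have := h 0 (by omega)
    rw [truncSplineDeriv2, Finset.sum_eq_zero] at this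
    · linarith
    · intro l _
      rw [max_eq_right]
      · simp
      · linarith [mesh_mono ha (Nat.zero_le (l + 1)) (show (l : ℕ) + 1 ≤ n + 1 by omega)]
  have c3 : c 3 = 0 := by
    have := h 1 (by omega)
    rw [truncSplineDeriv2, Finset.sum_eq_zero, c2] at this
    · have h01 := ha 0 (by omega)
      have : c 3 * (a 1 - a 0) = 0 := by linarith
      rcases mul_eq_zero.1 this with h | h
      · exact h
      · simp only [zero_add] at h01; linarith
    · intro l _
      rw [max_eq_right]
      · simp
      · linarith [mesh_mono ha (show 1 ≤ (l : ℕ) + 1 by omega) (show (l : ℕ) + 1 ≤ n + 1 by omega)]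
  refine ⟨c2, c3, ?_⟩
  have key : ∀ m (hm : m < n), d ⟨m, hm⟩ = 0 := by
    intro m
    induction m using Nat.strong_induction_on with
    | _ m ih =>
      intro hm
      have := h (m + 2) (by omega)
      rw [truncSplineDeriv2, Finset.sum_eq_single (⟨m, hm⟩ : Fin n), c2, c3] at this
      · have h01 := ha (m + 1) (by omega)
        rw [max_eq_left (by simpa using h01.le)] at this
        have : d ⟨m, hm⟩ * (a (m + 2) - a (m + 1)) = 0 := by
          simp only at this; linarith
        rcases mul_eq_zero.1 this with h | h
        · exact h
        · simp only [add_assoc, Nat.reduceAdd] at h01; linarith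
      · intro l _ hl
        rcases lt_trichotomy (l : ℕ) m with h | h | h
        · rw [show d l = 0 from ih l h l.2, zero_mul]
        · exact absurd (Fin.ext h) hl
        · rw [max_eq_right]
          · simp
          · linarith [mesh_mono ha (show m + 2 ≤ (l : ℕ) + 1 by omega)
              (show (l : ℕ) + 1 ≤ n + 1 by omega)]
      · simp
  exact funext fun l => key l l.2

/-- The interpolation conditions of a complete cubic spline, in the truncated power basis. -/
def interpolationMap (n : ℕ) (a : ℕ → ℝ) :
    ((Fin 4 → ℝ) × (Fin n → ℝ)) →ₗ[ℝ] ((Fin (n + 2) → ℝ) × ℝ × ℝ) where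
  toFun x := (fun j => truncSpline a x.1 x.2 (a j), truncSplineDeriv a x.1 x.2 (a 0),
    truncSplineDeriv a x.1 x.2 (a (n + 1)))
  map_add' x y := by
    ext <;> simp [truncSpline, truncSplineDeriv, add_mul, Finset.sum_add_distrib] <;> ring
  map_smul' r x := by
    ext <;> simp [truncSpline, truncSplineDeriv, mul_add, Finset.mul_sum, mul_assoc] <;> ring

/-- The second derivative of a complete cubic spline interpolating zero on a nearly uniform mesh
vanishes. -/
lemma IsCompleteCubicSpline.iteratedDerivWithin_eq_zero {k : ℕ} {g g' H : ℝ → ℝ} {ε : ℝ}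
    (hk : 2 ≤ k) (ha : ∀ j < k, a j < a (j + 1)) (hN : NearUniform k (gap k a) ε)
    (hε : ε ≤ 1 / 100) (hH : IsCompleteCubicSpline k a g g' H)
    (hq : ∀ j, dividedDiff k a g g' j = 0) {x : ℝ} (hx : x ∈ Icc (a 0) (a k)) :
    iteratedDerivWithin 2 H (Icc (a 0) (a k)) x = 0 := by
  obtain ⟨M, s, e1, e2, e3⟩ := hH.exists_jumps (by omega) ha
  -- Diagonal dominance with zero data makes all jumps vanish, so a single cubic remains.
  have hs : ∀ j, 1 ≤ j → j + 1 ≤ k → s (j + 1) = s j := by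
    intro j h1 h2
    have := hN.abs_mul_sq_le (E := fun j => s (j + 1) - s j) hε (T := 0) (fun i hi => by
      rw [fourthDiff_eq_jumpOp_of_spline ha e1 e2 hi,
        fourthDiff_eq_zero_of_const (c := 0) fun j _ _ => hq j]
      simp) h1 h2
    have p : 0 < gap k a j ^ 2 := pow_pos (gap_pos ha h1 (by omega)) 2
    have : |s (j + 1) - s j| ≤ 0 := by
      by_contra hc
      push Not at hc
      have := mul_pos p hc
      linarith
    linarith [abs_nonpos_iff.1 this]
  have g1 := gap_pos ha (j := 1) le_rfl (by omega)
  have g2 := gap_pos ha (j := 2) (by omega) (by omega)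
  have q0 := e1 0 (by omega)
  have q1 := e1 1 (by omega)
  have m0 := e2 0 (by omega)
  have s2 := hs 1 le_rfl (by omega)
  simp only [hq, gap_zero, zero_add, Nat.reduceAdd] at q0 q1 m0 s2
  rw [s2] at q1
  have M0 : M 0 = -(s 1 * gap k a 1) / 3 := by
    have : gap k a 1 * (M 0 + (s 1 * gap k a 1) / 3) = 0 := by linarith
    rcases mul_eq_zero.1 this with h | h <;> linarith
  -- With one third derivative throughout, the equations at the first two knots give `M 0 = -s 1 * h
  -- 1 / 3` and then `(h 1 + h 2)² * s 1 = 0`.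
  have s1 : s 1 = 0 := by
    have : (gap k a 1 + gap k a 2) ^ 2 * s 1 = 0 := by
      have : M 1 = -(s 1 * gap k a 1) / 3 + s 1 * gap k a 1 := by linarith
      rw [this] at q1
      nlinarith
    rcases mul_eq_zero.1 this with h | h
    · have : 0 < (gap k a 1 + gap k a 2) ^ 2 := by positivity
      linarith
    · exact h
  have sall : ∀ j < k, s (j + 1) = 0 := by
    intro j
    induction j with
    | zero => intro _; exact s1
    | succ m ih => intro hm; rw [hs (m + 1) (by omega) (by omega), ih (by omega)]
  have Mall : ∀ j < k, M j = 0 := by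
    intro j
    induction j with
    | zero => intro _; rw [M0, s1]; simp
    | succ m ih =>
      intro hm
      have := e2 m (by omega)
      rw [sall m (by omega), ih (by omega)] at this
      linarith
  obtain ⟨j, hj, hxj⟩ := exists_cell (by omega) hx
  rw [e3 j hj x hxj, Mall j hj, sall j hj]
  simp

/-- Zero data force a zero second derivative, which kills every coefficient except `c 0` and `c 1`.
These are the value and the slope at `a 0`. -/
lemma interpolationMap_injective {ε : ℝ} (hn : 1 ≤ n) (ha : ∀ j < n + 1, a j < a (j + 1))
    (hN : NearUniform (n + 1) (gap (n + 1) a) ε) (hε : ε ≤ 1 / 100) :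
    Function.Injective (interpolationMap n a) := by
  rw [injective_iff_map_eq_zero]
  rintro ⟨c, d⟩ h
  simp only [interpolationMap, LinearMap.coe_mk, AddHom.coe_mk, Prod.mk_eq_zero] at h
  obtain ⟨h1, h2, h3⟩ := h
  have h1' : ∀ j ≤ n + 1, truncSpline a c d (a j) = 0 := fun j hj =>
    congrFun h1 ⟨j, by omega⟩
  have h0k : a 0 < a (n + 1) := mesh_strictMono ha (Nat.succ_pos n) le_rfl
  have sp := isCompleteCubicSpline_truncSpline (g := fun _ => 0) (g' := fun _ => 0) c d ha h1' h2 h3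
  have z := truncSplineDeriv2_eq_zero_iff c d ha fun j hj => by
    have hx : a j ∈ Icc (a 0) (a (n + 1)) :=
      ⟨mesh_mono ha (Nat.zero_le j) hj, mesh_mono ha hj le_rfl⟩
    rw [← iteratedDerivWithin_truncSpline c d h0k hx]
    exact sp.iteratedDerivWithin_eq_zero (by omega) ha hN hε (fun j => by simp [dividedDiff]) hx
  obtain ⟨z2, z3, rfl⟩ := z
  have z0 := h1' 0 (by omega)
  have z1 := h2
  simp [truncSpline, truncSplineDeriv] at z0 z1
  refine Prod.ext (funext fun i => ?_) rfl
  fin_cases i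
  · exact z0
  · exact z1
  · exact z2
  · exact z3

/-- Existence of complete cubic splines on nearly uniform meshes. -/
lemma exists_isCompleteCubicSpline {k : ℕ} {ε : ℝ} (hk : 2 ≤ k) (ha : ∀ j < k, a j < a (j + 1))
    (hN : NearUniform k (gap k a) ε) (hε : ε ≤ 1 / 100) (g g' : ℝ → ℝ) :
    ∃ H, IsCompleteCubicSpline k a g g' H := by
  obtain ⟨n, rfl⟩ : ∃ n, k = n + 1 := ⟨k - 1, by omega⟩
  have inj := interpolationMap_injective (by omega) ha hN hε
  have surj : Function.Surjective (interpolationMap n a) := by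
    -- Dimensions agree: `4 + n` coefficients against `n + 2` values and two end slopes.
    rwa [← LinearMap.injective_iff_surjective_of_finrank_eq_finrank]
    simp
    ring
  obtain ⟨⟨c, d⟩, h⟩ := surj (fun j => g (a j), g' (a 0), g' (a (n + 1)))
  simp only [interpolationMap, LinearMap.coe_mk, AddHom.coe_mk, Prod.mk.injEq] at h
  obtain ⟨h1, h2, h3⟩ := h
  exact ⟨_, isCompleteCubicSpline_truncSpline c d ha
    (fun j hj => congrFun h1 ⟨j, by omega⟩) h2 h3⟩

end

/-! ### Cell means and consistency with the third derivative. -/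

/-- Means over the cells of a mesh, with the values at the end knots for the ghost cells. -/
def cellMean (k : ℕ) (a : ℕ → ℝ) (G : ℝ → ℝ) (i : ℕ) : ℝ :=
  if i = 0 then G (a 0) else if i ≤ k then (∫ t in a (i - 1)..a i, G t) / gap k a i else G (a k)

lemma dividedDiff_integral {k : ℕ} {a : ℕ → ℝ} {G : ℝ → ℝ}
    (hG : ∀ x y, IntervalIntegrable G volume x y) (i : ℕ) :
    dividedDiff k a (fun t => ∫ s in (0 : ℝ)..t, G s) G i = cellMean k a G i := by
  simp only [dividedDiff, cellMean]
  rw [intervalIntegral.integral_interval_sub_left (hG _ _) (hG _ _)]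

lemma fourthDiff_add (h q q' : ℕ → ℝ) (i : ℕ) :
    fourthDiff h (fun j => q j + q' j) i = fourthDiff h q i + fourthDiff h q' i := by
  simp only [fourthDiff, thirdDiff, secondDiff]; ring

lemma abs_cellMean_le {k : ℕ} {a : ℕ → ℝ} {G : ℝ → ℝ} {B : ℝ} (ha : ∀ j < k, a j < a (j + 1))
    {i : ℕ} (hi : i ≤ k + 1) (hG : ∀ t ∈ Icc (a (i - 1)) (a (min i k)), |G t| ≤ B) :
    |cellMean k a G i| ≤ B := by
  rw [cellMean]
  split_ifs with h0 hk
  · subst h0; exact hG _ (by simp)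
  · have hp := gap_pos ha (Nat.pos_of_ne_zero h0) hk
    rw [abs_div, abs_of_pos hp, div_le_iff₀ hp]
    obtain ⟨j, rfl⟩ : ∃ j, i = j + 1 := ⟨i - 1, by omega⟩
    rw [Nat.min_eq_left hk] at hG
    simp only [Nat.add_sub_cancel] at *
    have hlt := ha j hk
    have := intervalIntegral.norm_integral_le_of_norm_le_const (a := a j) (b := a (j + 1))
      (f := G) (C := B) (fun x hx => by
        rw [uIoc_of_le hlt.le] at hx
        exact hG x ⟨hx.1.le, hx.2⟩)
    rw [Real.norm_eq_abs, abs_of_pos (sub_pos.2 hlt)] at this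
    rwa [gap_succ a hk]
  · have : i = k + 1 := by omega
    subst this
    exact hG _ (by simp)

lemma cellMean_cubic {k : ℕ} {a : ℕ → ℝ} (ha : ∀ j < k, a j < a (j + 1)) (y e0 e1 e2 e3 : ℝ)
    {i : ℕ} (hi : i ≤ k + 1) :
    -- The indices are shifted so that cell `i` is `[x i, x (i + 1)]` up to the translation by `y`.
    -- For the ghosts `i = 0` and `i = k + 1` both ends coincide, and the formula becomes a point
    -- value.
    let x : ℕ → ℝ := fun j => a (min (j - 1) k) - y
    cellMean k a (fun t => e0 + e1 * (t - y) + e2 * (t - y) ^ 2 + e3 * (t - y) ^ 3) i =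
      e0 + e1 / 2 * (x i + x (i + 1)) + e2 / 3 * (x i ^ 2 + x i * x (i + 1) + x (i + 1) ^ 2) +
      e3 / 4 * (x i ^ 3 + x i ^ 2 * x (i + 1) + x i * x (i + 1) ^ 2 + x (i + 1) ^ 3) := by
  intro x
  simp only [x]
  rw [cellMean]
  split_ifs with h0 hk
  · subst h0; simp; ring
  · have hp := gap_pos ha (Nat.pos_of_ne_zero h0) hk
    obtain ⟨j, rfl⟩ : ∃ j, i = j + 1 := ⟨i - 1, by omega⟩
    have hlt := ha j hk
    rw [gap_succ a hk] at hp ⊢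
    simp only [Nat.add_sub_cancel]
    have hd : ∀ t, HasDerivAt (fun t => e0 * (t - y) + e1 / 2 * (t - y) ^ 2 +
        e2 / 3 * (t - y) ^ 3 + e3 / 4 * (t - y) ^ 4)
        (e0 + e1 * (t - y) + e2 * (t - y) ^ 2 + e3 * (t - y) ^ 3) t := by
      intro t
      have h := (hasDerivAt_id t).sub_const y
      have := (((h.const_mul e0).add ((h.pow 2).const_mul (e1 / 2))).add
        ((h.pow 3).const_mul (e2 / 3))).add ((h.pow 4).const_mul (e3 / 4))
      refine this.congr_deriv ?_
      simp
      ring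
    rw [intervalIntegral.integral_eq_sub_of_hasDerivAt (fun t _ => hd t)
      (by apply Continuous.intervalIntegrable; fun_prop), div_eq_iff hp.ne',
      Nat.min_eq_left hk, Nat.min_eq_left (show j ≤ k by omega)]
    ring
  · have : i = k + 1 := by omega
    subst this
    simp; ring

lemma fourthDiff_cellMean_cubic {k : ℕ} {a : ℕ → ℝ} (ha : ∀ j < k, a j < a (j + 1))
    (y e0 e1 e2 e3 : ℝ) {i : ℕ} (hi : i + 2 ≤ k) :
    fourthDiff (gap k a)
      (cellMean k a (fun t => e0 + e1 * (t - y) + e2 * (t - y) ^ 2 + e3 * (t - y) ^ 3)) i =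
      6 * (e3 / 4) * (gap k a i + gap k a (i + 1) + gap k a (i + 2) + gap k a (i + 3)) := by
  refine fourthDiff_cubic (x := fun j => a (min (j - 1) k) - y) (fun j _ hj => ?_)
    (fun j _ hj => cellMean_cubic ha y e0 e1 e2 e3 (by omega))
    (gap_nonneg ha (by omega)) (gap_pos ha (by omega) (by omega))
    (gap_pos ha (by omega) (by omega)) (gap_nonneg ha (by omega))
  simp only [Nat.add_sub_cancel, gap]
  rw [Nat.min_eq_left (show j - 1 ≤ k by omega)]
  ring

lemma cellMean_sub {k : ℕ} {a : ℕ → ℝ} {G G' : ℝ → ℝ} (ha : ∀ j < k, a j < a (j + 1))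
    (hG : ContinuousOn G (Icc (a 0) (a k))) (hG' : ContinuousOn G' (Icc (a 0) (a k))) (i : ℕ) :
    cellMean k a (fun t => G t - G' t) i = cellMean k a G i - cellMean k a G' i := by
  simp only [cellMean]
  split_ifs with h0 hk
  · rfl
  · have h1 : a (i - 1) ≤ a i := mesh_mono ha (by omega) hk
    have sub : uIcc (a (i - 1)) (a i) ⊆ Icc (a 0) (a k) := by
      rw [uIcc_of_le h1]
      exact Icc_subset_Icc (mesh_mono ha (by omega) (by omega)) (mesh_mono ha hk le_rfl)
    rw [intervalIntegral.integral_sub (hG.mono sub).intervalIntegrable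
      (hG'.mono sub).intervalIntegrable, sub_div]
  · rfl

/-- A function vanishing at `y`, with derivative bounded by `C`, is bounded by `C * ρ` at distance
`ρ` from `y`. -/
lemma abs_le_of_hasDerivWithinAt {G G' : ℝ → ℝ} {A B y C ρ : ℝ} (hy : y ∈ Icc A B) (hρ : 0 ≤ ρ)
    (hG : ∀ t ∈ Icc A B, HasDerivWithinAt G (G' t) (Icc A B) t) (h0 : G y = 0) (hC : 0 ≤ C)
    (hG' : ∀ t ∈ Icc A B, |t - y| ≤ ρ → |G' t| ≤ C) :
    ∀ t ∈ Icc A B, |t - y| ≤ ρ → |G t| ≤ C * ρ := by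
  intro t ht hty
  set S := Icc A B ∩ Icc (y - ρ) (y + ρ)
  have hS : Convex ℝ S := (convex_Icc _ _).inter (convex_Icc _ _)
  have hd : ∀ x ∈ S, HasDerivWithinAt G (G' x) S x := fun x hx =>
    (hG x hx.1).mono inter_subset_left
  have hb : ∀ x ∈ S, ‖G' x‖ ≤ C := fun x hx => hG' x hx.1 (by
    rw [abs_le]; constructor <;> linarith [hx.2.1, hx.2.2])
  have ht' := abs_le.1 hty
  have := hS.norm_image_sub_le_of_norm_hasDerivWithin_le hd hb
    (x := y) (y := t) ⟨hy, by constructor <;> linarith⟩ ⟨ht, by constructor <;> linarith⟩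
  rw [h0, sub_zero, Real.norm_eq_abs, Real.norm_eq_abs] at this
  exact this.trans (by gcongr)

/-- Third order Taylor expansion with a remainder controlled by the oscillation of the third
derivative. -/
lemma abs_taylor_remainder_le {F f f1 f2 : ℝ → ℝ} {A B y ω ρ : ℝ} (hy : y ∈ Icc A B) (hρ : 0 ≤ ρ)
    (hω : 0 ≤ ω)
    (hF : ∀ t ∈ Icc A B, HasDerivWithinAt F (f t) (Icc A B) t)
    (hf : ∀ t ∈ Icc A B, HasDerivWithinAt f (f1 t) (Icc A B) t)
    (hf1 : ∀ t ∈ Icc A B, HasDerivWithinAt f1 (f2 t) (Icc A B) t)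
    (hf2 : ∀ t ∈ Icc A B, |t - y| ≤ ρ → |f2 t - f2 y| ≤ ω) :
    ∀ t ∈ Icc A B, |t - y| ≤ ρ → |F t - (F y + f y * (t - y) + f1 y / 2 * (t - y) ^ 2 +
      f2 y / 6 * (t - y) ^ 3)| ≤ ω * ρ * ρ * ρ := by
  have s1 := abs_le_of_hasDerivWithinAt (G := fun t => f1 t - (f1 y + f2 y * (t - y))) hy hρ
    (G' := fun t => f2 t - f2 y) (C := ω) (fun t ht => by
      have h := ((hasDerivAt_id t).sub_const y).hasDerivWithinAt (s := Icc A B)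
      refine ((hf1 t ht).sub ((h.const_mul (f2 y)).const_add (f1 y))).congr_deriv ?_
      simp) (by simp) hω hf2
  have s2 := abs_le_of_hasDerivWithinAt (G := fun t => f t - (f y + f1 y * (t - y) +
      f2 y / 2 * (t - y) ^ 2)) hy hρ (fun t ht => by
      have h := ((hasDerivAt_id t).sub_const y).hasDerivWithinAt (s := Icc A B)
      refine ((hf t ht).sub (((h.const_mul (f1 y)).const_add (f y)).add
        ((h.pow 2).const_mul (f2 y / 2)))).congr_deriv ?_
      simp
      ring) (by simp) (by positivity) s1
  exact abs_le_of_hasDerivWithinAt hy hρ (fun t ht => by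
      have h := ((hasDerivAt_id t).sub_const y).hasDerivWithinAt (s := Icc A B)
      refine ((hF t ht).sub ((((h.const_mul (f y)).const_add (F y)).add
        ((h.pow 2).const_mul (f1 y / 2))).add ((h.pow 3).const_mul (f2 y / 6)))).congr_deriv ?_
      simp
      ring) (by simp) (by positivity) s2

/-- The fourth differences of a smooth function are consistent with the jump system at the scaled
values of its third derivative. -/
lemma NearUniform.fourthDiff_sub_jumpOp_le {k : ℕ} {a : ℕ → ℝ} {ε ω B L : ℝ}
    {F f f1 f2 : ℝ → ℝ} (ha : ∀ j < k, a j < a (j + 1)) (hN : NearUniform k (gap k a) ε)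
    (hε : 0 ≤ ε) (hε' : ε ≤ 1 / 100)
    (hL : ∀ j < k, a (j + 1) - a j ≤ L) (hω : 0 ≤ ω)
    (hF : ∀ t ∈ Icc (a 0) (a k), HasDerivWithinAt F (f t) (Icc (a 0) (a k)) t)
    (hf : ∀ t ∈ Icc (a 0) (a k), HasDerivWithinAt f (f1 t) (Icc (a 0) (a k)) t)
    (hf1 : ∀ t ∈ Icc (a 0) (a k), HasDerivWithinAt f1 (f2 t) (Icc (a 0) (a k)) t)
    (hB : ∀ t ∈ Icc (a 0) (a k), |f2 t| ≤ B)
    (hf2 : ∀ t ∈ Icc (a 0) (a k), ∀ y ∈ Icc (a 0) (a k), |t - y| ≤ 2 * L → |f2 t - f2 y| ≤ ω)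
    {i : ℕ} (hi : i + 2 ≤ k) :
    gap k a (i + 1) ^ 2 * |fourthDiff (gap k a) (cellMean k a F) i -
      jumpOp (gap k a) (fun j => f2 (a j) * gap k a j) i| ≤ (322 * ω + 21 * B * ε) * L ^ 3 := by
  set y := a (i + 1) with hy
  have memI : ∀ j ≤ k, a j ∈ Icc (a 0) (a k) := fun j hj =>
    ⟨mesh_mono ha (Nat.zero_le j) hj, mesh_mono ha hj le_rfl⟩
  have hyI : y ∈ Icc (a 0) (a k) := memI _ (by omega)
  have hL0 : 0 < L := (sub_pos.2 (ha 0 (by omega))).trans_le (hL 0 (by omega))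
  have hB0 : 0 ≤ B := (abs_nonneg _).trans (hB _ hyI)
  set P : ℝ → ℝ := fun t => F y + f y * (t - y) + f1 y / 2 * (t - y) ^ 2 + f2 y / 6 * (t - y) ^ 3
    with hP
  have rem := abs_taylor_remainder_le (ρ := 2 * L) hyI (by positivity) hω hF hf hf1
    (fun t ht h => hf2 t ht y hyI h)
  have cF : ContinuousOn F (Icc (a 0) (a k)) := fun t ht => (hF t ht).continuousWithinAt
  have dec : ∀ j, cellMean k a F j = cellMean k a P j + cellMean k a (fun t => F t - P t) j := by
    intro j
    rw [cellMean_sub ha cF (by apply Continuous.continuousOn; fun_prop)]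
    ring
  have upper : a (min (i + 3) k) ≤ y + 2 * L ∧ y ≤ a (min (i + 3) k) := by
    have h1 := hL (i + 1) (by omega)
    refine ⟨?_, mesh_mono ha (by omega) (by omega)⟩
    rcases Nat.lt_or_ge k (i + 3) with h | h
    · rw [Nat.min_eq_right (by omega), show k = i + 1 + 1 by omega]; linarith
    · have h2 := hL (i + 2) (by omega)
      rw [Nat.min_eq_left h]
      simp only [show i + 1 + 1 = i + 2 from rfl, show i + 2 + 1 = i + 3 from rfl] at h1 h2
      linarith
  have lower : y - 2 * L ≤ a (i - 1) := by
    have h1 := hL i (by omega)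
    rcases Nat.eq_zero_or_pos i with rfl | h
    · simp only [Nat.zero_sub, hy] at *; linarith
    · have h2 := hL (i - 1) (by omega)
      rw [Nat.sub_add_cancel h] at h2
      linarith
  -- The window lies within `2 * L` of `y`, so the Taylor remainder is at most `8 * ω * L ^ 3` and
  -- its fourth difference costs 320 `ω L³`. The variation of `f2` in the jump operator adds 2, for
  -- a total of 322.
  have small : gap k a (i + 1) ^ 2 * |fourthDiff (gap k a) (cellMean k a (fun t => F t - P t)) i| ≤
      40 * (ω * (2 * L) * (2 * L) * (2 * L)) := by
    refine hN.fourthDiff_bound hε' hi fun j j1 j2 => ?_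
    refine abs_cellMean_le ha (by omega) fun t ht => ?_
    have l1 : a (i - 1) ≤ a (j - 1) := mesh_mono ha (by omega) (by omega)
    have u1 : a (min j k) ≤ a (min (i + 3) k) := mesh_mono ha (by omega) (by omega)
    refine rem t ⟨(mesh_mono ha (Nat.zero_le _) (by omega)).trans ht.1,
      ht.2.trans (mesh_mono ha (by omega) le_rfl)⟩ ?_
    rw [abs_le]
    constructor <;> linarith [ht.1, ht.2]
  have poly := hN.abs_sum_sub_jumpOp_le (v := fun j => f2 (a j)) (ω := ω) hε hε' hi (hB _ hyI)
    (fun j j1 j2 j3 j4 => hf2 _ (memI j (by omega)) _ hyI (by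
      have l1 : a (i - 1) ≤ a j := mesh_mono ha (by omega) (by omega)
      have u1 : a j ≤ a (min (i + 3) k) := mesh_mono ha (by omega) (by omega)
      rw [abs_le]
      constructor <;> linarith [upper.1]))
  have e : fourthDiff (gap k a) (cellMean k a F) i =
      f2 y * (gap k a i + gap k a (i + 1) + gap k a (i + 2) + gap k a (i + 3)) / 4 +
        fourthDiff (gap k a) (cellMean k a (fun t => F t - P t)) i := by
    rw [funext dec, fourthDiff_add, hP, fourthDiff_cellMean_cubic ha _ _ _ _ _ hi]
    ring
  have g0 := gap_pos ha (show 1 ≤ i + 1 by omega) (by omega)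
  have gL : gap k a (i + 1) ≤ L := by rw [gap_succ a (by omega)]; exact hL i (by omega)
  have p1 : gap k a (i + 1) ^ 2 * ((21 * B * ε + 2 * ω) * gap k a (i + 1)) ≤
      (21 * B * ε + 2 * ω) * L ^ 3 := by
    rw [show gap k a (i + 1) ^ 2 * ((21 * B * ε + 2 * ω) * gap k a (i + 1)) =
      (21 * B * ε + 2 * ω) * gap k a (i + 1) ^ 3 by ring]
    gcongr
  have p2 := mul_le_mul_of_nonneg_left poly (sq_nonneg (gap k a (i + 1)))
  have tri := abs_add_le (f2 y * (gap k a i + gap k a (i + 1) + gap k a (i + 2) +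
    gap k a (i + 3)) / 4 - jumpOp (gap k a) (fun j => f2 (a j) * gap k a j) i)
    (fourthDiff (gap k a) (cellMean k a (fun t => F t - P t)) i)
  rw [e, add_sub_right_comm]
  have p3 := mul_le_mul_of_nonneg_left tri (sq_nonneg (gap k a (i + 1)))
  refine p3.trans ?_
  rw [mul_add]
  nlinarith

/-! ### The distribution function and its quantile knots. -/

section

lemma IsDecreasingConvexDensity.isProbabilityMeasure {f : ℝ → ℝ}
    (hf : IsDecreasingConvexDensity f) : IsProbabilityMeasure (law f) :=
  ⟨by rw [law, withDensity_apply _ MeasurableSet.univ, Measure.restrict_univ,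
    hf.lintegral_eq_one]⟩

/-- A lower bound for a density with finite `ratioR`. -/
lemma exists_pos_le_of_ratioR_lt_top {f : ℝ → ℝ} {τ : ℝ} (hR : ratioR f τ < ⊤) :
    ∃ m, 0 < m ∧ ∀ t ∈ Ioo 0 τ, m ≤ f t := by
  have h0 : (⨅ t ∈ Ioo 0 τ, ENNReal.ofReal (f t)) ≠ 0 := by
    intro h
    rw [ratioR, h, ENNReal.div_zero] at hR
    · exact lt_irrefl _ hR
    · exact (lt_of_lt_of_le one_pos (le_max_left _ _)).ne'
  obtain ⟨m, hm0, hm⟩ := ENNReal.lt_iff_exists_nnreal_btwn.1 (pos_iff_ne_zero.2 h0)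
  refine ⟨m, by exact_mod_cast hm0, fun t ht => ?_⟩
  have := hm.le.trans (iInf₂_le t ht)
  by_contra hlt
  push Not at hlt
  rcases le_or_gt (f t) 0 with h | h
  · rw [ENNReal.ofReal_of_nonpos h] at this
    exact hm0.ne' (le_antisymm this bot_le)
  · rw [← ENNReal.ofReal_coe_nnreal, ENNReal.ofReal_le_ofReal_iff h.le] at this
    linarith

lemma betaTwo_mul_le {f : ℝ → ℝ} {τ t : ℝ} (hβ : 0 < betaTwo f τ) (ht : t ∈ Ioo 0 τ)
    (hft : 0 < f t) : betaTwo f τ * f t ^ 3 ≤ iteratedDeriv 2 f t := by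
  -- The infimum of a real set unbounded below is 0 by convention, which `hβ` excludes.
  have hb : BddBelow ((fun t => iteratedDeriv 2 f t / f t ^ 3) '' Ioo 0 τ) := by
    by_contra h
    rw [betaTwo, Real.sInf_of_not_bddBelow h] at hβ
    exact lt_irrefl _ hβ
  have := csInf_le hb (mem_image_of_mem _ ht)
  rw [← le_div_iff₀ (by positivity)]
  exact this

/-- The setting: a density which is continuous and bounded below on `[0, τ]`. -/
structure IsRegularOn (f : ℝ → ℝ) (τ m : ℝ) : Prop where
  density : IsDecreasingConvexDensity f
  tau_pos : 0 < τ
  low_pos : 0 < m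
  low : ∀ t ∈ Icc 0 τ, m ≤ f t
  cont : ContinuousOn f (Icc 0 τ)

variable {f : ℝ → ℝ} {τ m : ℝ}

lemma IsRegularOn.distFun_eq (hf : IsRegularOn f τ m) {t : ℝ} (ht : t ∈ Icc 0 τ) :
    distFun f t = ∫ s in (0 : ℝ)..t, f s := by
  have hI : IntegrableOn f (Ioc 0 t) :=
    ((hf.cont.mono (Icc_subset_Icc_right ht.2)).integrableOn_Icc).mono_set Ioc_subset_Icc_self
  have h0 : 0 ≤ᵐ[volume.restrict (Ioc 0 t)] f := by
    filter_upwards [ae_restrict_mem measurableSet_Ioc] with s hs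
    exact hf.density.nonneg s hs.1
  rw [distFun, Measure.real, law, withDensity_apply _ measurableSet_Iic,
    Measure.restrict_restrict measurableSet_Iic, inter_comm, Ioi_inter_Iic,
    ← ofReal_integral_eq_lintegral_ofReal hI h0, ENNReal.toReal_ofReal (integral_nonneg_of_ae h0),
    intervalIntegral.integral_of_le ht.1]

lemma distFun_of_nonpos {t : ℝ} (ht : t ≤ 0) : distFun f t = 0 := by
  rw [distFun, Measure.real, law, withDensity_apply _ measurableSet_Iic,
    Measure.restrict_restrict measurableSet_Iic, inter_comm, Ioi_inter_Iic, Ioc_eq_empty_of_le ht]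
  simp

lemma IsRegularOn.distFun_mono (hf : IsRegularOn f τ m) : Monotone (distFun f) := by
  have := hf.density.isProbabilityMeasure
  exact fun s t h => measureReal_mono (Iic_subset_Iic.2 h)

lemma IsRegularOn.law_Ioc (hf : IsRegularOn f τ m) {s t : ℝ} (h : s ≤ t) :
    (law f).real (Ioc s t) = distFun f t - distFun f s := by
  have := hf.density.isProbabilityMeasure
  rw [← Iic_sdiff_Iic, measureReal_sdiff (Iic_subset_Iic.2 h) measurableSet_Iic]
  rfl

/-- Extending `f` from `[0, τ]` by constants gives a continuous integrand on the line, so the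
fundamental theorem of calculus also covers the one-sided derivatives at the ends. -/
lemma IsRegularOn.hasDerivWithinAt_distFun (hf : IsRegularOn f τ m) {t : ℝ} (ht : t ∈ Icc 0 τ) :
    HasDerivWithinAt (distFun f) (f t) (Icc 0 τ) t := by
  have hc : Continuous (IccExtend hf.tau_pos.le ((Icc 0 τ).domRestrict f)) :=
    (continuousOn_iff_continuous_domRestrict.1 hf.cont).Icc_extend'
  have heq : ∀ s ∈ Icc 0 τ, IccExtend hf.tau_pos.le ((Icc 0 τ).domRestrict f) s = f s := fun s hs => by
    rw [IccExtend_of_mem _ _ hs]; rfl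
  have h := (hc.integral_hasStrictDerivAt 0 t).hasDerivAt.hasDerivWithinAt (s := Icc 0 τ)
  rw [heq t ht] at h
  refine h.congr_of_mem (fun s hs => ?_) ht
  rw [hf.distFun_eq hs]
  refine intervalIntegral.integral_congr fun x hx => (heq x ?_).symm
  rw [uIcc_of_le hs.1] at hx
  exact ⟨hx.1, hx.2.trans hs.2⟩

lemma IsRegularOn.continuousOn_distFun (hf : IsRegularOn f τ m) :
    ContinuousOn (distFun f) (Icc 0 τ) :=
  fun _ ht => (hf.hasDerivWithinAt_distFun ht).continuousWithinAt

lemma IsRegularOn.exists_slope (hf : IsRegularOn f τ m) {s t : ℝ} (hs : 0 ≤ s) (hst : s < t)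
    (ht : t ≤ τ) : ∃ ξ ∈ Ioo s t, distFun f t - distFun f s = f ξ * (t - s) := by
  obtain ⟨ξ, hξ, h⟩ := exists_hasDerivAt_eq_slope (distFun f) f hst
    (hf.continuousOn_distFun.mono (Icc_subset_Icc hs ht)) (fun x hx =>
      (hf.hasDerivWithinAt_distFun ⟨hs.trans hx.1.le, hx.2.le.trans ht⟩).hasDerivAt
        (Icc_mem_nhds (hs.trans_lt hx.1) (hx.2.trans_le ht)))
  refine ⟨ξ, hξ, ?_⟩
  rw [h, div_mul_cancel₀ _ (sub_pos.2 hst).ne']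

lemma IsRegularOn.distFun_strictMonoOn (hf : IsRegularOn f τ m) :
    StrictMonoOn (distFun f) (Icc 0 τ) := by
  intro s hs t ht hst
  obtain ⟨ξ, hξ, h⟩ := hf.exists_slope hs.1 hst ht.2
  have := mul_pos (hf.low_pos.trans_le (hf.low ξ ⟨hs.1.trans hξ.1.le, hξ.2.le.trans ht.2⟩))
    (sub_pos.2 hst)
  linarith

lemma IsRegularOn.distFun_tau_pos (hf : IsRegularOn f τ m) : 0 < distFun f τ := by
  have := hf.distFun_strictMonoOn (left_mem_Icc.2 hf.tau_pos.le) (right_mem_Icc.2 hf.tau_pos.le)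
    hf.tau_pos
  rwa [distFun_of_nonpos le_rfl] at this

lemma IsRegularOn.alphaZero_eq (hf : IsRegularOn f τ m) : alphaZero (distFun f) = 0 := by
  refine IsGreatest.csSup_eq ⟨distFun_of_nonpos le_rfl, fun x hx => ?_⟩
  by_contra hlt
  push Not at hlt
  have h1 : 0 < distFun f (min x τ) := by
    have := hf.distFun_strictMonoOn (left_mem_Icc.2 hf.tau_pos.le)
      (⟨(lt_min hlt hf.tau_pos).le, min_le_right _ _⟩ : min x τ ∈ Icc 0 τ) (lt_min hlt hf.tau_pos)
    rwa [distFun_of_nonpos le_rfl] at this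
  have := hf.distFun_mono (min_le_left x τ)
  rw [mem_ofPred_eq] at hx
  linarith

lemma IsRegularOn.quantile_distFun (hf : IsRegularOn f τ m) {x : ℝ} (hx0 : 0 < x) (hx : x ≤ τ) :
    quantile (distFun f) (distFun f x) = x := by
  refine IsLeast.csInf_eq ⟨le_refl (distFun f x), fun y hy => ?_⟩
  by_contra hlt
  push Not at hlt
  have h1 := hf.distFun_strictMonoOn (a := max y 0) ⟨le_max_right _ _, max_le (by linarith)
    hf.tau_pos.le⟩ ⟨hx0.le, hx⟩ (max_lt hlt hx0)
  have := hf.distFun_mono (le_max_left y 0)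
  rw [mem_ofPred_eq] at hy
  linarith

lemma IsRegularOn.knot_zero (hf : IsRegularOn f τ m) (k : ℕ) : knot (distFun f) τ k 0 = 0 := by
  rw [knot, if_pos rfl, hf.alphaZero_eq]

lemma IsRegularOn.knot_last (hf : IsRegularOn f τ m) {k : ℕ} (hk : 0 < k) :
    knot (distFun f) τ k k = τ := by
  have : (k : ℝ) ≠ 0 := by positivity
  rw [knot, if_neg hk.ne', div_self this, one_mul, hf.quantile_distFun hf.tau_pos le_rfl]

lemma IsRegularOn.knot_spec (hf : IsRegularOn f τ m) {k j : ℕ} (hk : 0 < k) (hj : j ≤ k) :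
    knot (distFun f) τ k j ∈ Icc 0 τ ∧
      distFun f (knot (distFun f) τ k j) = j * (distFun f τ / k) := by
  rcases Nat.eq_zero_or_pos j with rfl | h
  · rw [hf.knot_zero, distFun_of_nonpos le_rfl]
    simpa using hf.tau_pos.le
  · have hk' : (0 : ℝ) < k := by exact_mod_cast hk
    have hj' : (0 : ℝ) < j := by exact_mod_cast h
    have hF := hf.distFun_tau_pos
    have hle : (j : ℝ) / k * distFun f τ ≤ distFun f τ := by
      have : (j : ℝ) / k ≤ 1 := by
        rw [div_le_one hk']; exact_mod_cast hj
      nlinarith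
    have hpos : 0 < (j : ℝ) / k * distFun f τ := by positivity
    obtain ⟨x, hx, hxe⟩ := intermediate_value_Icc hf.tau_pos.le hf.continuousOn_distFun
      (show (j : ℝ) / k * distFun f τ ∈ Icc (distFun f 0) (distFun f τ) by
        rw [distFun_of_nonpos le_rfl]; exact ⟨hpos.le, hle⟩)
    have hx0 : 0 < x := by
      rcases hx.1.eq_or_lt with h0 | h0
      · rw [← h0, distFun_of_nonpos le_rfl] at hxe
        linarith
      · exact h0
    rw [knot, if_neg h.ne', ← hxe, hf.quantile_distFun hx0 hx.2]
    exact ⟨hx, by rw [hxe]; ring⟩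

lemma IsRegularOn.knot_lt (hf : IsRegularOn f τ m) {k j : ℕ} (hj : j < k) :
    knot (distFun f) τ k j < knot (distFun f) τ k (j + 1) := by
  have hk : 0 < k := by omega
  obtain ⟨m1, e1⟩ := hf.knot_spec hk hj.le
  obtain ⟨m2, e2⟩ := hf.knot_spec hk (Nat.succ_le_of_lt hj)
  rw [← hf.distFun_strictMonoOn.lt_iff_lt m1 m2, e1, e2]
  have : 0 < distFun f τ / k := div_pos hf.distFun_tau_pos (by exact_mod_cast hk)
  push_cast
  linarith

/-- All cells have the same probability, so by the mean value theorem comparing lengths amounts to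
comparing values of `f` at nearby points. -/
lemma IsRegularOn.exists_cell_slope (hf : IsRegularOn f τ m) {k j : ℕ} (hj : j < k) :
    ∃ ξ ∈ Ioo (knot (distFun f) τ k j) (knot (distFun f) τ k (j + 1)),
      f ξ * gap k (knot (distFun f) τ k) (j + 1) = distFun f τ / k ∧ m ≤ f ξ := by
  have hk : 0 < k := by omega
  obtain ⟨m1, e1⟩ := hf.knot_spec hk hj.le
  obtain ⟨m2, e2⟩ := hf.knot_spec hk (Nat.succ_le_of_lt hj)
  obtain ⟨ξ, hξ, h⟩ := hf.exists_slope m1.1 (hf.knot_lt hj) m2.2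
  refine ⟨ξ, hξ, ?_, hf.low ξ ⟨m1.1.trans hξ.1.le, hξ.2.le.trans m2.2⟩⟩
  rw [gap_succ _ hj, ← h, e1, e2]
  push_cast
  ring

lemma IsRegularOn.gap_le (hf : IsRegularOn f τ m) {k j : ℕ} (hj : j < k) :
    knot (distFun f) τ k (j + 1) - knot (distFun f) τ k j ≤ distFun f τ / k / m := by
  obtain ⟨ξ, hξ, h, hm⟩ := hf.exists_cell_slope hj
  rw [gap_succ _ hj] at h
  rw [le_div_iff₀ hf.low_pos, ← h, mul_comm]
  have := sub_pos.2 (hf.knot_lt hj)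
  gcongr

/-- From `f ξ * h i = f ξ' * h j`, the relative difference of lengths is `|f ξ' - f ξ| / f ξ`. Cells
with indices at most two apart span at most three cells, hence the factor 3 in `hk`. -/
lemma IsRegularOn.nearUniform (hf : IsRegularOn f τ m) {k : ℕ} {ε δ : ℝ}
    (hδ : ∀ x ∈ Icc 0 τ, ∀ y ∈ Icc 0 τ, |x - y| ≤ δ → |f x - f y| ≤ ε * m)
    (hε : 0 ≤ ε) (hk : 3 * (distFun f τ / k / m) ≤ δ) :
    NearUniform k (gap k (knot (distFun f) τ k)) ε := by
  set a := knot (distFun f) τ k with ha_def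
  have ha : ∀ j < k, a j < a (j + 1) := fun j hj => hf.knot_lt hj
  refine ⟨gap_zero _ _, gap_last _ _, fun j h1 h2 => gap_pos ha h1 h2, ?_⟩
  intro i j i1 i2 j1 j2 hij hji
  obtain ⟨i, rfl⟩ : ∃ i', i = i' + 1 := ⟨i - 1, by omega⟩
  obtain ⟨j, rfl⟩ : ∃ i', j = i' + 1 := ⟨j - 1, by omega⟩
  obtain ⟨ξ, hξ, h, hm⟩ := hf.exists_cell_slope (show i < k by omega)
  obtain ⟨ξ', hξ', h', hm'⟩ := hf.exists_cell_slope (show j < k by omega)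
  rw [← ha_def] at hξ hξ' h h'
  have far : ∀ i j, i ≤ j → j ≤ i + 3 → j ≤ k → a j ≤ a i + 3 * (distFun f τ / k / m) := by
    intro i j h1 h2 h3
    have g0 : 0 ≤ distFun f τ / k / m :=
      div_nonneg (div_nonneg hf.distFun_tau_pos.le (Nat.cast_nonneg k)) hf.low_pos.le
    have step : ∀ l < k, a (l + 1) ≤ a l + distFun f τ / k / m := fun l hl => by
      linarith [hf.gap_le hl]
    obtain rfl | rfl | rfl | rfl : j = i ∨ j = i + 1 ∨ j = i + 1 + 1 ∨ j = i + 1 + 1 + 1 := by omega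
    · linarith
    · linarith [step i (by omega)]
    · linarith [step i (by omega), step (i + 1) (by omega)]
    · linarith [step i (by omega), step (i + 1) (by omega), step (i + 1 + 1) (by omega)]
  have memI : ∀ l < k, ∀ x ∈ Ioo (a l) (a (l + 1)), x ∈ Icc 0 τ := fun l hl x hx =>
    ⟨(hf.knot_spec (by omega) hl.le).1.1.trans hx.1.le,
      hx.2.le.trans (hf.knot_spec (by omega) (Nat.succ_le_of_lt hl)).1.2⟩
  have close : |ξ' - ξ| ≤ δ := by
    refine le_trans ?_ hk
    rw [abs_le]
    rcases le_total i j with hle | hle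
    · have b1 := far i (j + 1) (by omega) (by omega) (by omega)
      have b2 : a (i + 1) ≤ a (j + 1) := mesh_mono ha (by omega) (by omega)
      have b3 : a i ≤ a j := mesh_mono ha (by omega) (by omega)
      constructor <;> linarith [hξ.1, hξ.2, hξ'.1, hξ'.2]
    · have b1 := far j (i + 1) (by omega) (by omega) (by omega)
      have b2 : a (j + 1) ≤ a (i + 1) := mesh_mono ha (by omega) (by omega)
      have b3 : a j ≤ a i := mesh_mono ha (by omega) (by omega)
      constructor <;> linarith [hξ.1, hξ.2, hξ'.1, hξ'.2]
  have hfd := hδ ξ' (memI j (by omega) _ hξ') ξ (memI i (by omega) _ hξ) close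
  have gj := gap_pos ha (show 1 ≤ j + 1 by omega) (by omega)
  have e : f ξ * (gap k a (i + 1) - gap k a (j + 1)) = (f ξ' - f ξ) * gap k a (j + 1) := by
    linarith
  have fpos : 0 < f ξ := hf.low_pos.trans_le hm
  have : f ξ * |gap k a (i + 1) - gap k a (j + 1)| ≤ f ξ * (ε * gap k a (j + 1)) := by
    rw [← abs_of_pos fpos, ← abs_mul, abs_of_pos fpos, e, abs_mul, abs_of_pos gj]
    calc _ ≤ ε * m * gap k a (j + 1) := by gcongr
      _ ≤ ε * f ξ * gap k a (j + 1) := by gcongr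
      _ = _ := by ring
  exact le_of_mul_le_mul_left this fpos

lemma IsRegularOn.le_density_mul_gap (hf : IsRegularOn f τ m) {k j : ℕ} {ε δ : ℝ}
    (hδ : ∀ x ∈ Icc 0 τ, ∀ y ∈ Icc 0 τ, |x - y| ≤ δ → |f x - f y| ≤ ε * m)
    (hε : 0 ≤ ε) (hk : distFun f τ / k / m ≤ δ) (hj : j < k) :
    (1 - ε) * (distFun f τ / k) ≤
      f (knot (distFun f) τ k (j + 1)) * gap k (knot (distFun f) τ k) (j + 1) := by
  obtain ⟨ξ, hξ, h, hm⟩ := hf.exists_cell_slope hj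
  have m1 := (hf.knot_spec (by omega) hj.le).1
  have m2 := (hf.knot_spec (by omega) (Nat.succ_le_of_lt hj)).1
  have g := hf.gap_le hj
  have := hδ _ m2 ξ ⟨m1.1.trans hξ.1.le, hξ.2.le.trans m2.2⟩ (by
    rw [abs_le]; constructor <;> linarith [hξ.1, hξ.2])
  have gp := gap_pos (fun j hj => hf.knot_lt (k := k) (j := j) hj) (show 1 ≤ j + 1 by omega)
    (show j + 1 ≤ k by omega)
  rw [← h, ← mul_assoc]
  gcongr
  have := (abs_le.1 this).1
  nlinarith

end

/-! ### Bernstein's inequality and concentration of fourth differences. -/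

section

/-- A Bernstein type inequality for bounded functions of independent observations. -/
lemma measureReal_sum_ge_le {Ω : Type*} [MeasurableSpace Ω] {P : Measure Ω}
    [IsProbabilityMeasure P] {μ : Measure ℝ} [IsProbabilityMeasure μ] {n : ℕ} {X : Fin n → Ω → ℝ}
    (hX : ∀ i, HasLaw (X i) μ P) (hI : iIndepFun X P) {ψ : ℝ → ℝ} (hψ : Measurable ψ)
    {C v r t : ℝ} (hC : ∀ x, |ψ x| ≤ C) (hv : ∫ x, ψ x ^ 2 ∂μ ≤ v) (hr : 0 ≤ r) (hrC : r * C ≤ 1) :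
    P.real {ω | n * t ≤ ∑ i, (ψ (X i ω) - ∫ x, ψ x ∂μ)} ≤
      Real.exp (-(n * (r * t - r ^ 2 * v))) := by
  have hC0 : 0 ≤ C := (abs_nonneg _).trans (hC 0)
  have intψ : Integrable ψ μ := Integrable.of_bound hψ.aestronglyMeasurable C
    (Filter.Eventually.of_forall hC)
  have intψ2 : Integrable (fun x => ψ x ^ 2) μ :=
    Integrable.of_bound (hψ.pow_const 2).aestronglyMeasurable (C ^ 2)
      (Filter.Eventually.of_forall fun x => by
        rw [norm_pow]; exact pow_le_pow_left₀ (norm_nonneg _) (hC x) 2)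
  -- The inequality `exp u ≤ 1 + u + u²` for `|u| ≤ 1`, which is why `r * C ≤ 1` is needed.
  have bnd : ∀ x, Real.exp (r * ψ x) ≤ 1 + r * ψ x + r ^ 2 * ψ x ^ 2 := by
    intro x
    have h1 : |r * ψ x| ≤ 1 := by
      rw [abs_mul, abs_of_nonneg hr]
      exact (mul_le_mul_of_nonneg_left (hC x) hr).trans hrC
    have := (abs_le.1 (Real.abs_exp_sub_one_sub_id_le h1)).2
    nlinarith
  have single : ∫ x, Real.exp (r * ψ x) ∂μ ≤ Real.exp (r * ∫ x, ψ x ∂μ + r ^ 2 * v) := by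
    calc ∫ x, Real.exp (r * ψ x) ∂μ ≤ ∫ x, (1 + r * ψ x + r ^ 2 * ψ x ^ 2) ∂μ := by
          refine integral_mono_of_nonneg (Filter.Eventually.of_forall fun x => (Real.exp_pos _).le)
            ?_ (Filter.Eventually.of_forall bnd)
          exact ((integrable_const _).add (intψ.const_mul r)).add (intψ2.const_mul _)
      _ = 1 + r * ∫ x, ψ x ∂μ + r ^ 2 * ∫ x, ψ x ^ 2 ∂μ := by
          have i1 : Integrable (fun x => 1 + r * ψ x) μ :=
            (integrable_const _).add (intψ.const_mul r)
          rw [integral_add i1 (intψ2.const_mul _),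
            integral_add (integrable_const _) (intψ.const_mul r), integral_const_mul,
            integral_const_mul]
          simp
      _ ≤ 1 + (r * ∫ x, ψ x ∂μ + r ^ 2 * v) := by
          have := mul_le_mul_of_nonneg_left hv (sq_nonneg r)
          linarith
      _ ≤ _ := by
          rw [add_comm]; exact Real.add_one_le_exp _
  have hmgf : ∀ i, mgf (ψ ∘ X i) P r ≤ Real.exp (r * ∫ x, ψ x ∂μ + r ^ 2 * v) := by
    intro i
    refine le_of_eq_of_le ?_ single
    exact (hX i).integral_comp (f := fun x => Real.exp (r * ψ x)) (by fun_prop)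
  have indep : iIndepFun (fun i => ψ ∘ X i) P := hI.comp (fun _ => ψ) fun _ => hψ
  have meas : ∀ i, AEMeasurable (ψ ∘ X i) P := fun i => hψ.comp_aemeasurable (hX i).aemeasurable
  have hsum : mgf (∑ i, ψ ∘ X i) P r ≤ Real.exp (r * ∫ x, ψ x ∂μ + r ^ 2 * v) ^ n := by
    rw [indep.mgf_sum₀ meas]
    calc _ ≤ ∏ _i : Fin n, Real.exp (r * ∫ x, ψ x ∂μ + r ^ 2 * v) :=
          Finset.prod_le_prod (fun i _ => mgf_nonneg) fun i _ => hmgf i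
      _ = _ := by simp
  have chern := measure_ge_le_exp_mul_mgf (μ := P) (X := ∑ i, ψ ∘ X i)
    (n * t + n * ∫ x, ψ x ∂μ) hr (by
      refine Integrable.of_bound (C := Real.exp (r * (n * C))) ?_
        (Filter.Eventually.of_forall fun ω => ?_)
      · have : AEMeasurable (∑ i, ψ ∘ X i) P := Finset.aemeasurable_sum _ fun i _ => meas i
        exact (Real.measurable_exp.comp_aemeasurable (this.const_mul r)).aestronglyMeasurable
      · rw [Real.norm_eq_abs, abs_of_pos (Real.exp_pos _), Real.exp_le_exp]
        refine mul_le_mul_of_nonneg_left ?_ hr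
        rw [Finset.sum_apply]
        calc _ ≤ ∑ _i : Fin n, C := Finset.sum_le_sum fun i _ => (le_abs_self _).trans (hC _)
          _ = n * C := by simp)
  have ev : {ω | n * t ≤ ∑ i, (ψ (X i ω) - ∫ x, ψ x ∂μ)} =
      {ω | n * t + n * ∫ x, ψ x ∂μ ≤ (∑ i, ψ ∘ X i) ω} := by
    ext ω
    simp only [mem_ofPred_eq, Finset.sum_sub_distrib, Finset.sum_apply, Function.comp,
      Finset.sum_const, Finset.card_univ, Fintype.card_fin, nsmul_eq_mul]
    constructor <;> intro h <;> linarith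
  rw [ev]
  refine chern.trans ((mul_le_mul_of_nonneg_left hsum (Real.exp_pos _).le).trans ?_)
  rw [← Real.exp_nat_mul, ← Real.exp_add, Real.exp_le_exp]
  linarith

lemma measureReal_abs_mean_ge_le {Ω : Type*} [MeasurableSpace Ω] {P : Measure Ω}
    [IsProbabilityMeasure P] {μ : Measure ℝ} [IsProbabilityMeasure μ] {n : ℕ} (hn : 0 < n)
    {X : Fin n → Ω → ℝ} (hX : ∀ i, HasLaw (X i) μ P) (hI : iIndepFun X P) {ψ : ℝ → ℝ}
    (hψ : Measurable ψ) {C v t : ℝ} (hC : ∀ x, |ψ x| ≤ C) (hv : ∫ x, ψ x ^ 2 ∂μ ≤ v)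
    (hv0 : 0 < v) (ht : 0 ≤ t) (htC : t * C ≤ 2 * v) :
    P.real {ω | t ≤ |(∑ i, ψ (X i ω)) / n - ∫ x, ψ x ∂μ|} ≤
      2 * Real.exp (-(n * (t ^ 2 / (4 * v)))) := by
  -- The choice `r = t / (2 * v)` maximises `r * t - r ^ 2 * v`. The constraint `r * C ≤ 1` then
  -- reads `t * C ≤ 2 * v`.
  have hr : 0 ≤ t / (2 * v) := by positivity
  have hrC : t / (2 * v) * C ≤ 1 := by
    rw [div_mul_eq_mul_div, div_le_one (by positivity)]; exact htC
  have h1 := measureReal_sum_ge_le hX hI hψ hC hv hr hrC (t := t)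
  have h2 := measureReal_sum_ge_le hX hI hψ.neg (C := C) (v := v) (by simpa using hC)
    (by simpa using hv) hr hrC (t := t)
  have e : t / (2 * v) * t - (t / (2 * v)) ^ 2 * v = t ^ 2 / (4 * v) := by
    field_simp; ring
  rw [e] at h1 h2
  have hn' : (0 : ℝ) < n := by exact_mod_cast hn
  refine (measureReal_mono (s₂ := {ω | n * t ≤ ∑ i, (ψ (X i ω) - ∫ x, ψ x ∂μ)} ∪
    {ω | n * t ≤ ∑ i, ((-ψ) (X i ω) - ∫ x, (-ψ) x ∂μ)}) ?_).trans
    ((measureReal_union_le _ _).trans (by linarith))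
  intro ω hω
  have hω : t ≤ |(∑ i, ψ (X i ω)) / n - ∫ x, ψ x ∂μ| := hω
  simp only [mem_union, mem_ofPred_eq, Pi.neg_apply, integral_neg, Finset.sum_sub_distrib,
    Finset.sum_neg_distrib, Finset.sum_const, Finset.card_univ, Fintype.card_fin, nsmul_eq_mul]
  have e1 : (∑ i, ψ (X i ω)) = n * ((∑ i, ψ (X i ω)) / n) := by field_simp
  rcases le_abs'.1 hω with h | h
  · right; rw [e1]; nlinarith
  · left; rw [e1]; nlinarith

/-- The distribution function of a point mass at `x`. -/
def stepFun (x t : ℝ) : ℝ := if x ≤ t then 1 else 0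

lemma stepFun_monotone (x : ℝ) : Monotone (stepFun x) := by
  intro s t h
  unfold stepFun
  split_ifs <;> linarith

lemma stepFun_antitone (t : ℝ) : Antitone fun x => stepFun x t := by
  intro s t h
  simp only [stepFun]
  split_ifs <;> linarith

lemma abs_stepFun_le (x t : ℝ) : |stepFun x t| ≤ 1 := by
  unfold stepFun; split_ifs <;> simp

lemma intervalIntegrable_stepFun (x s t : ℝ) : IntervalIntegrable (stepFun x) volume s t :=
  (stepFun_monotone x).intervalIntegrable

lemma measurable_uncurry_stepFun : Measurable (Function.uncurry stepFun) :=
  Measurable.ite (measurableSet_le measurable_fst measurable_snd) measurable_const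
    measurable_const

lemma integral_stepFun (μ : Measure ℝ) (t : ℝ) : ∫ x, stepFun x t ∂μ = μ.real (Iic t) := by
  have : (fun x => stepFun x t) = (Iic t).indicator 1 := by
    ext x; simp [stepFun, indicator, mem_Iic]
  rw [this, integral_indicator_one measurableSet_Iic]

lemma empDistFun_eq {n : ℕ} (x : Fin n → ℝ) (t : ℝ) :
    empDistFun x t = ∑ i, (n : ℝ)⁻¹ * stepFun (x i) t := by
  rw [empDistFun, ← Finset.mul_sum, Finset.card_filter, div_eq_inv_mul]
  push_cast
  rfl

lemma intervalIntegrable_empDistFun {n : ℕ} (x : Fin n → ℝ) (s t : ℝ) :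
    IntervalIntegrable (empDistFun x) volume s t := by
  have e : empDistFun x = ∑ i, fun t => (n : ℝ)⁻¹ * stepFun (x i) t := by
    ext t
    rw [empDistFun_eq, Finset.sum_apply]
  rw [e]
  exact IntervalIntegrable.sum (f := fun i t => (n : ℝ)⁻¹ * stepFun (x i) t) Finset.univ
    (fun i _ => (intervalIntegrable_stepFun (x i) s t).const_mul (n : ℝ)⁻¹)

lemma cellMean_empDistFun {k n : ℕ} (a : ℕ → ℝ) (x : Fin n → ℝ) (j : ℕ) :
    cellMean k a (empDistFun x) j = (∑ i, cellMean k a (stepFun (x i)) j) / n := by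
  rw [div_eq_inv_mul, Finset.mul_sum]
  simp only [cellMean]
  split_ifs with h0 hk
  · rw [empDistFun_eq]
  · rw [funext (empDistFun_eq x), intervalIntegral.integral_finsetSum
      (fun i _ => (intervalIntegrable_stepFun (x i) _ _).const_mul (n : ℝ)⁻¹)]
    simp only [intervalIntegral.integral_const_mul, Finset.sum_div, mul_div_assoc]
  · rw [empDistFun_eq]

variable {k : ℕ} {a : ℕ → ℝ}

/-- Moving the point mass to the right lowers its distribution function, so the cell mean is
antitone in `x`. -/
lemma measurable_cellMean_stepFun (ha : ∀ j < k, a j < a (j + 1)) (j : ℕ) :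
    Measurable fun x => cellMean k a (stepFun x) j := by
  refine Antitone.measurable fun x y h => ?_
  simp only [cellMean]
  split_ifs with h0 hk
  · exact stepFun_antitone _ h
  · refine div_le_div_of_nonneg_right ?_ (gap_pos ha (by omega) hk).le
    exact intervalIntegral.integral_mono_on (mesh_mono ha (by omega) hk)
      (intervalIntegrable_stepFun _ _ _) (intervalIntegrable_stepFun _ _ _)
      fun t _ => stepFun_antitone t h
  · exact stepFun_antitone _ h

lemma abs_cellMean_stepFun_le (ha : ∀ j < k, a j < a (j + 1)) {j : ℕ} (hj : j ≤ k + 1) (x : ℝ) :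
    |cellMean k a (stepFun x) j| ≤ 1 :=
  abs_cellMean_le ha hj fun t _ => abs_stepFun_le x t

lemma integral_cellMean_stepFun (μ : Measure ℝ) [IsFiniteMeasure μ] (j : ℕ) :
    ∫ x, cellMean k a (stepFun x) j ∂μ = cellMean k a (fun t => μ.real (Iic t)) j := by
  simp only [cellMean]
  split_ifs with h0 hk
  · exact integral_stepFun μ _
  · rw [integral_div]
    congr 1
    have hint : Integrable (Function.uncurry fun s x => stepFun x s)
        ((volume.restrict (uIoc (a (j - 1)) (a j))).prod μ) := by
      have : IsFiniteMeasure (volume.restrict (uIoc (a (j - 1)) (a j))) :=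
        ⟨by rw [Measure.restrict_apply_univ, uIoc]; exact measure_Ioc_lt_top⟩
      refine Integrable.of_bound (C := 1) ?_ (Filter.Eventually.of_forall fun z =>
        abs_stepFun_le z.2 z.1)
      exact (measurable_uncurry_stepFun.comp measurable_swap).aestronglyMeasurable
    rw [← intervalIntegral_integral_swap hint]
    exact intervalIntegral.integral_congr fun t _ => integral_stepFun μ t
  · exact integral_stepFun μ _

lemma cellMean_eq_of_const (ha : ∀ j < k, a j < a (j + 1)) {G : ℝ → ℝ} {c : ℝ} {i : ℕ}
    (hi : i ≤ k + 1) (hG : ∀ t ∈ Icc (a (i - 1)) (a (min i k)), G t = c) :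
    cellMean k a G i = c := by
  rw [cellMean]
  split_ifs with h0 hk
  · subst h0; exact hG _ (by simp)
  · have hp := gap_pos ha (Nat.pos_of_ne_zero h0) hk
    have h1 : a (i - 1) ≤ a i := mesh_mono ha (by omega) hk
    rw [Nat.min_eq_left hk] at hG
    rw [intervalIntegral.integral_congr (g := fun _ => c) (fun t ht => hG t (by
      rwa [uIcc_of_le h1] at ht))]
    have : a i - a (i - 1) = gap k a i := by rw [gap, Nat.min_eq_left hk]
    rw [intervalIntegral.integral_const, smul_eq_mul, this]
    field_simp
  · have : i = k + 1 := by omega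
    subst this
    exact hG _ (by simp)

/-- Fourth differences of the empirical distribution concentrate around those of the law. -/
lemma NearUniform.measureReal_fourthDiff_ge_le {Ω : Type*} [MeasurableSpace Ω] {P : Measure Ω}
    [IsProbabilityMeasure P] {μ : Measure ℝ} [IsProbabilityMeasure μ] {n : ℕ} (hn : 0 < n)
    {X : Fin n → Ω → ℝ} (hX : ∀ i, HasLaw (X i) μ P) (hI : iIndepFun X P) {ε p T : ℝ}
    (ha : ∀ j < k, a j < a (j + 1)) (hN : NearUniform k (gap k a) ε) (hε : ε ≤ 1 / 100)
    (hp : 0 < p) (hT : 0 ≤ T) (hTp : T ≤ 320 * p) {i : ℕ} (hi : i + 2 ≤ k)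
    (hμ : μ.real (Ioc (a (i - 1)) (a (min (i + 3) k))) ≤ 4 * p) :
    P.real {ω | T ≤ gap k a (i + 1) ^ 2 *
      |fourthDiff (gap k a) (cellMean k a (empDistFun fun l => X l ω)) i -
        fourthDiff (gap k a) (cellMean k a fun t => μ.real (Iic t)) i|} ≤
      2 * Real.exp (-(n * (T ^ 2 / (4 * (6400 * p))))) := by
  obtain ⟨c, hc⟩ := fourthDiff_linear (gap k a) i
  set w := gap k a (i + 1) ^ 2 with hw
  have hw0 : 0 ≤ w := sq_nonneg _
  set ψ : ℝ → ℝ := fun x => w * fourthDiff (gap k a) (cellMean k a (stepFun x)) i with hψ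
  have hψm : Measurable ψ := by
    simp only [hψ, hc]
    exact (Finset.measurable_sum _ fun l _ =>
      (measurable_cellMean_stepFun ha _).const_mul (c l)).const_mul w
  have hψb : ∀ x, |ψ x| ≤ 40 := by
    intro x
    have := hN.fourthDiff_bound hε hi (q := cellMean k a (stepFun x)) (Q := 1)
      fun j _ hj => abs_cellMean_stepFun_le ha (by omega) x
    rw [hψ, abs_mul, abs_of_nonneg hw0]
    linarith
  have hsupp : ∀ x, x ∉ Ioc (a (i - 1)) (a (min (i + 3) k)) → ψ x = 0 := by
    intro x hx
    have : ∃ d, ∀ j, i ≤ j → j ≤ i + 3 → cellMean k a (stepFun x) j = d := by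
      by_cases h : x ≤ a (i - 1)
      · refine ⟨1, fun j h1 h2 => cellMean_eq_of_const ha (by omega) fun t ht => ?_⟩
        have : a (i - 1) ≤ a (j - 1) := mesh_mono ha (by omega) (by omega)
        rw [stepFun, if_pos (by linarith [ht.1])]
      · refine ⟨0, fun j h1 h2 => cellMean_eq_of_const ha (by omega) fun t ht => ?_⟩
        have : a (min j k) ≤ a (min (i + 3) k) := mesh_mono ha (by omega) (by omega)
        rw [stepFun, if_neg]
        intro hxt
        exact hx ⟨not_le.1 h, by linarith [ht.2]⟩
    obtain ⟨d, hd⟩ := this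
    rw [hψ]
    simp only
    rw [fourthDiff_eq_zero_of_const hd, mul_zero]
  -- `ψ` is at most 40 in absolute value and lives on a set of probability at most `4 * p`: 1600
  -- times 4 is 6400. The requirement `40 * T ≤ 2 * 6400 * p` of the tail bound is `hTp`.
  have hv : ∫ x, ψ x ^ 2 ∂μ ≤ 6400 * p := by
    set S := Ioc (a (i - 1)) (a (min (i + 3) k))
    calc ∫ x, ψ x ^ 2 ∂μ ≤ ∫ x, S.indicator (fun _ => (1600 : ℝ)) x ∂μ := by
          refine integral_mono_of_nonneg (Filter.Eventually.of_forall fun x => sq_nonneg _)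
            ((integrable_const _).indicator measurableSet_Ioc)
            (Filter.Eventually.of_forall fun x => ?_)
          by_cases hx : x ∈ S
          · rw [indicator_of_mem hx]
            have := pow_le_pow_left₀ (abs_nonneg _) (hψb x) 2
            rw [sq_abs] at this
            norm_num at this
            exact this
          · rw [indicator_of_notMem hx]
            simp [hsupp x hx]
      _ = μ.real S * 1600 := by
          rw [integral_indicator measurableSet_Ioc, setIntegral_const, smul_eq_mul]
      _ ≤ _ := by linarith
  have hmean : ∫ x, ψ x ∂μ = w * fourthDiff (gap k a) (cellMean k a fun t => μ.real (Iic t)) i := by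
    simp only [hψ, hc]
    rw [integral_const_mul, integral_finsetSum]
    · simp only [integral_const_mul, integral_cellMean_stepFun]
    · intro l _
      refine Integrable.const_mul ?_ _
      exact Integrable.of_bound (measurable_cellMean_stepFun ha _).aestronglyMeasurable 1
        (Filter.Eventually.of_forall fun x => abs_cellMean_stepFun_le ha (by omega) x)
  have hemp : ∀ x : Fin n → ℝ, w * fourthDiff (gap k a) (cellMean k a (empDistFun x)) i =
      (∑ l, ψ (x l)) / n := by
    intro x
    simp only [hψ, hc, cellMean_empDistFun]
    rw [← Finset.mul_sum, mul_div_assoc, Finset.sum_comm, Finset.sum_div]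
    congr 1
    refine Finset.sum_congr rfl fun l _ => ?_
    rw [← Finset.mul_sum, mul_div_assoc]
  have := measureReal_abs_mean_ge_le hn hX hI hψm hψb hv (by positivity) hT (by linarith)
  convert this using 5 with ω
  rw [← hemp, hmean, ← mul_sub, abs_mul, abs_of_nonneg hw0]

end

/-! ### Assembly of the estimate. -/

/-- On a mesh where the residual and the noise are small compared to the profile, the spline
interpolant of the integrated empirical distribution has a convex second derivative. -/
lemma splineSecondDerivConvex_of_close {f v : ℝ → ℝ} {τ m ε T : ℝ} (hf : IsRegularOn f τ m) {k n : ℕ}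
    (hk : 2 ≤ k) (x : Fin n → ℝ)
    (hN : NearUniform k (gap k (knot (distFun f) τ k)) ε) (hε : ε ≤ 1 / 100)
    (hr : ∀ i, i + 2 ≤ k → gap k (knot (distFun f) τ k) (i + 1) ^ 2 *
      |fourthDiff (gap k (knot (distFun f) τ k)) (cellMean k (knot (distFun f) τ k) (distFun f)) i -
      jumpOp (gap k (knot (distFun f) τ k)) (fun j => v (knot (distFun f) τ k j) *
        gap k (knot (distFun f) τ k) j) i| ≤ T)
    (hn : ∀ i, i + 2 ≤ k → gap k (knot (distFun f) τ k) (i + 1) ^ 2 *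
      |fourthDiff (gap k (knot (distFun f) τ k)) (cellMean k (knot (distFun f) τ k)
        (empDistFun x)) i -
      fourthDiff (gap k (knot (distFun f) τ k)) (cellMean k (knot (distFun f) τ k)
        (distFun f)) i| ≤ T)
    (hv : ∀ j, 1 ≤ j → j + 1 ≤ k → 8 * T ≤ gap k (knot (distFun f) τ k) j ^ 2 *
      (v (knot (distFun f) τ k j) * gap k (knot (distFun f) τ k) j)) :
    SplineSecondDerivConvex (distFun f) τ k x := by
  have ha : ∀ j < k, knot (distFun f) τ k j < knot (distFun f) τ k (j + 1) :=
    fun j hj => hf.knot_lt hj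
  refine ⟨exists_isCompleteCubicSpline hk ha hN hε _ _, fun H hH => ?_⟩
  obtain ⟨M, s, e1, e2, e3⟩ := hH.exists_jumps (by omega) ha
  have hq : ∀ j, dividedDiff k (knot (distFun f) τ k) (intEmpDistFun x) (empDistFun x) j =
      cellMean k (knot (distFun f) τ k) (empDistFun x) j :=
    dividedDiff_integral (intervalIntegrable_empDistFun x)
  simp only [hq] at e1
  have key := convexOn_of_affine_pieces (by omega) ha e2 (fun j h1 h2 =>
    hN.nonneg_of_close (E := fun j => s (j + 1) - s j) hε
      (fun i hi => fourthDiff_eq_jumpOp_of_spline ha e1 e2 hi) hr hn h1 h2 (hv j h1 h2)) e3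
  rwa [hf.knot_zero, hf.knot_last (by omega)] at key

end ConvexSpline
end

open ConvexSpline in
theorem lemma3p3 (f : ℝ → ℝ) (τ : ℝ)
    (hf : ConvexSpline.IsDecreasingConvexDensity f)
    (hτ : 0 < τ) (hτ1 : (τ : EReal) < ConvexSpline.alphaOne (ConvexSpline.distFun f))
    (hsmooth : ContDiffOn ℝ 2 f (Set.Icc 0 τ))
    (hβ : 0 < ConvexSpline.betaTwo f τ)
    (hγ : ConvexSpline.gammaTildeOne f τ < ⊤)
    (hR : ConvexSpline.ratioR f τ < ⊤) :
    ∃ k₀ : ℕ, ∀ k : ℕ, k₀ ≤ k → ∀ n : ℕ, 0 < n →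
      ∀ (Ω : Type*) [MeasurableSpace Ω] (P : MeasureTheory.Measure Ω)
        [MeasureTheory.IsProbabilityMeasure P] (X : Fin n → Ω → ℝ),
        (∀ i, ProbabilityTheory.HasLaw (X i) (ConvexSpline.law f) P) →
        ProbabilityTheory.iIndepFun X P →
        P.real {ω | ¬ ConvexSpline.SplineSecondDerivConvex (ConvexSpline.distFun f) τ k
            (fun i => X i ω)} ≤
          12 * k * Real.exp (-(1 / 4246732800) * ConvexSpline.betaTwo f τ ^ 2 * n *
            (ConvexSpline.distFun f τ / k) ^ 5) := by
  obtain ⟨m, hm, hlow⟩ := exists_pos_le_of_ratioR_lt_top hR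
  have hu : UniqueDiffOn ℝ (Icc 0 τ) := uniqueDiffOn_Icc hτ
  have hreg : IsRegularOn f τ m := by
    refine ⟨hf, hτ, hm, fun t ht => ?_, hsmooth.continuousOn⟩
    have hcl : closure (Ioo 0 τ) = Icc 0 τ := closure_Ioo hτ.ne
    exact le_on_closure hlow continuousOn_const (hcl ▸ hsmooth.continuousOn) (hcl ▸ ht)
  set I := Icc 0 τ with hI
  set f1 := derivWithin f I with hf1
  set f2 := derivWithin f1 I with hf2
  have c1 : ContDiffOn ℝ 1 f1 I := hsmooth.derivWithin hu (by norm_num)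
  have c2 : ContinuousOn f2 I := (c1.derivWithin (m := 0) hu (by norm_num)).continuousOn
  have d0 : ∀ t ∈ I, HasDerivWithinAt f (f1 t) I t := fun t ht =>
    (hsmooth.differentiableOn (by norm_num) t ht).hasDerivWithinAt
  have d1 : ∀ t ∈ I, HasDerivWithinAt f1 (f2 t) I t := fun t ht =>
    (c1.differentiableOn (by norm_num) t ht).hasDerivWithinAt
  have hf2eq : ∀ t ∈ Ioo 0 τ, iteratedDeriv 2 f t = f2 t := by
    intro t ht
    rw [← iteratedDerivWithin_eq_iteratedDeriv hu
      (hsmooth.contDiffAt (Icc_mem_nhds ht.1 ht.2)) (Ioo_subset_Icc_self ht),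
      iteratedDerivWithin_succ, iteratedDerivWithin_one]
  obtain ⟨B, hB⟩ := isCompact_Icc.exists_bound_of_continuousOn c2
  have hB0 : 0 ≤ B := (norm_nonneg _).trans (hB 0 (left_mem_Icc.2 hτ.le))
  set β := betaTwo f τ with hβdef
  -- Since lengths are at most `p / m`, the residual is at most `(322 ω₀ + 21 B ε) (p / m)³`. Each
  -- of the two terms is allotted half of `β m³ / 16`. The `B + 1` avoids division by zero.
  set ω₀ := β * m ^ 3 / 16 / 644 with hω₀
  set ε := min (1 / 100) (β * m ^ 3 / 16 / (42 * (B + 1))) with hε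
  have hω₀p : 0 < ω₀ := by positivity
  have hεp : 0 < ε := lt_min (by norm_num) (by positivity)
  have hε1 : ε ≤ 1 / 100 := min_le_left _ _
  have hbudget : (322 * ω₀ + 21 * B * ε) / m ^ 3 ≤ β / 16 := by
    have h1 : ε ≤ β * m ^ 3 / 16 / (42 * (B + 1)) := min_le_right _ _
    rw [le_div_iff₀ (by positivity)] at h1
    rw [div_le_iff₀ (by positivity), hω₀]
    nlinarith
  obtain ⟨δ1, hδ1, hδf⟩ := Metric.uniformContinuousOn_iff_le.1
    (isCompact_Icc.uniformContinuousOn_of_continuous hsmooth.continuousOn) (ε * m) (by positivity)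
  obtain ⟨δ2, hδ2, hδf2⟩ := Metric.uniformContinuousOn_iff_le.1
    (isCompact_Icc.uniformContinuousOn_of_continuous c2) ω₀ hω₀p
  have hF := hreg.distFun_tau_pos
  have hlim := tendsto_const_div_atTop_nhds_zero_nat (distFun f τ)
  -- The thresholds keep three cells within `δ1` and two within `δ2`, and give `p < 1` and `β p < 1`
  -- for `T ≤ 320 p`. They are fixed before `n` and the sample.
  obtain ⟨k₀, hk₀⟩ := Filter.eventually_atTop.1 ((hlim.eventually (gt_mem_nhds
    (show 0 < min (min (m * δ1 / 3) (m * δ2 / 2)) (min 1 (1 / β)) by positivity))).and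
    (Filter.eventually_ge_atTop 2))
  refine ⟨k₀, fun k hk n hn Ω _ P _ X hX hInd => ?_⟩
  obtain ⟨hpk, hk2⟩ := hk₀ k hk
  have hk0 : (0 : ℝ) < k := by exact_mod_cast (by omega : 0 < k)
  set p := distFun f τ / k with hp
  have hp0 : 0 < p := div_pos hF hk0
  simp only [lt_min_iff] at hpk
  obtain ⟨⟨hp1, hp2⟩, hp3, hp4⟩ := hpk
  have hL1 : 3 * (p / m) ≤ δ1 := by
    rw [← mul_div_assoc, div_le_iff₀ hm]; linarith
  have hL2 : 2 * (p / m) ≤ δ2 := by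
    rw [← mul_div_assoc, div_le_iff₀ hm]; linarith
  have hL0 : 0 < p / m := by positivity
  set a := knot (distFun f) τ k with ha_def
  have ha : ∀ j < k, a j < a (j + 1) := fun j hj => hreg.knot_lt hj
  have a0 : a 0 = 0 := hreg.knot_zero k
  have ak : a k = τ := hreg.knot_last (by omega)
  have hNU : NearUniform k (gap k a) ε :=
    hreg.nearUniform hδf hεp.le hL1
  -- Then `8 * T = β p³ / 2`, safely below the profile's lower bound `β (0.99 p)³`.
  set T := β * p ^ 3 / 16 with hT
  have hT0 : 0 ≤ T := by positivity
  have hTp : T ≤ 320 * p := by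
    have h1 : β * p ≤ 1 := by
      rw [lt_div_iff₀ hβ] at hp4; linarith
    rw [hT]
    nlinarith [mul_pos hp0 hp0]
  have res : ∀ i, i + 2 ≤ k → gap k a (i + 1) ^ 2 *
      |fourthDiff (gap k a) (cellMean k a (distFun f)) i -
      jumpOp (gap k a) (fun j => f2 (a j) * gap k a j) i| ≤ T := by
    intro i hi
    have := hNU.fourthDiff_sub_jumpOp_le (F := distFun f) (f := f) (f1 := f1) (f2 := f2) (B := B)
      (ω := ω₀) (L := p / m) ha hεp.le hε1 (fun j hj => hreg.gap_le hj) hω₀p.le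
      (by rw [a0, ak]; exact fun t ht => hreg.hasDerivWithinAt_distFun ht)
      (by rw [a0, ak]; exact d0) (by rw [a0, ak]; exact d1) (by rw [a0, ak]; exact hB)
      (by rw [a0, ak]; exact fun t ht y hy h => hδf2 t ht y hy (h.trans hL2)) hi
    refine this.trans ?_
    calc _ = (322 * ω₀ + 21 * B * ε) / m ^ 3 * p ^ 3 := by field_simp
      _ ≤ β / 16 * p ^ 3 := by gcongr
      _ = T := by rw [hT]; ring
  have prof : ∀ j, 1 ≤ j → j + 1 ≤ k →
      8 * T ≤ gap k a j ^ 2 * (f2 (a j) * gap k a j) := by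
    intro j j1 j2
    obtain ⟨l, rfl⟩ : ∃ l, j = l + 1 := ⟨j - 1, by omega⟩
    have haj : a (l + 1) ∈ Ioo 0 τ := by
      rw [← a0, ← ak]
      exact ⟨mesh_strictMono ha (by omega) (by omega), mesh_strictMono ha (by omega) le_rfl⟩
    have fp : 0 < f (a (l + 1)) := hm.trans_le (hlow _ haj)
    have g0 := gap_pos ha (show 1 ≤ l + 1 by omega) (show l + 1 ≤ k by omega)
    have b1 : β * f (a (l + 1)) ^ 3 ≤ f2 (a (l + 1)) := by
      rw [← hf2eq _ haj]; exact betaTwo_mul_le hβ haj fp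
    have b2 : (1 - ε) * p ≤ f (a (l + 1)) * gap k a (l + 1) :=
      hreg.le_density_mul_gap hδf hεp.le (by linarith) (show l < k by omega)
    have b3 : 99 / 100 * p ≤ f (a (l + 1)) * gap k a (l + 1) := by nlinarith
    calc 8 * T ≤ β * (99 / 100 * p) ^ 3 := by
          rw [hT]
          have : 0 ≤ β * p ^ 3 := by positivity
          nlinarith
      _ ≤ β * (f (a (l + 1)) * gap k a (l + 1)) ^ 3 := by gcongr
      _ = gap k a (l + 1) ^ 2 * (β * f (a (l + 1)) ^ 3 * gap k a (l + 1)) := by ring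
      _ ≤ _ := by gcongr
  have := hf.isProbabilityMeasure
  set bad : ℕ → Set Ω := fun i => {ω | T ≤ gap k a (i + 1) ^ 2 *
      |fourthDiff (gap k a) (cellMean k a (empDistFun fun l => X l ω)) i -
        fourthDiff (gap k a) (cellMean k a fun t => (law f).real (Iic t)) i|} with hbad
  -- Only monotonicity of the measure is used afterwards, so no measurability of the event on the
  -- left is required.
  have cover : {ω | ¬ SplineSecondDerivConvex (distFun f) τ k fun i => X i ω} ⊆
      ⋃ i ∈ Finset.range (k - 1), bad i := by
    intro ω hω
    by_contra hno
    simp only [mem_iUnion, not_exists, Finset.mem_range] at hno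
    refine hω (splineSecondDerivConvex_of_close hreg hk2 _ hNU hε1 res (fun i hi => ?_) prof)
    have := hno i (by omega)
    simp only [hbad, mem_ofPred_eq, not_le] at this
    exact this.le
  have tail : ∀ i ∈ Finset.range (k - 1), P.real (bad i) ≤
      2 * Real.exp (-(n * (T ^ 2 / (4 * (6400 * p))))) := by
    intro i hi
    rw [Finset.mem_range] at hi
    refine hNU.measureReal_fourthDiff_ge_le hn hX hInd ha hε1 hp0 hT0 hTp (by omega) ?_
    rw [hreg.law_Ioc (mesh_mono ha (by omega) (by omega)),
      (hreg.knot_spec (by omega) (by omega : min (i + 3) k ≤ k)).2,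
      (hreg.knot_spec (by omega) (by omega : i - 1 ≤ k)).2, ← sub_mul]
    -- The window has at most four cells. Truncated subtraction at `i = 0` only makes it shorter.
    have : ((min (i + 3) k : ℕ) : ℝ) ≤ ((i - 1 : ℕ) : ℝ) + 4 := by
      exact_mod_cast (by omega : min (i + 3) k ≤ i - 1 + 4)
    gcongr
    linarith
  calc _ ≤ P.real (⋃ i ∈ Finset.range (k - 1), bad i) :=
        measureReal_mono cover (measure_ne_top _ _)
    _ ≤ ∑ i ∈ Finset.range (k - 1), P.real (bad i) := measureReal_biUnion_finset_le _ _
    _ ≤ ∑ i ∈ Finset.range (k - 1), 2 * Real.exp (-(n * (T ^ 2 / (4 * (6400 * p))))) :=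
        Finset.sum_le_sum tail
    _ = (k - 1 : ℕ) * (2 * Real.exp (-(n * (T ^ 2 / (4 * (6400 * p)))))) := by simp
    _ ≤ k * (12 * Real.exp (-(1 / 4246732800) * β ^ 2 * n * p ^ 5)) := by
        gcongr
        · omega
        · norm_num
        -- The denominator is 16² * 4 * 6400 = 6553600, well below the claimed 4246732800. Likewise
        -- the prefactor is 2 rather than 12.
        · have e : T ^ 2 / (4 * (6400 * p)) = β ^ 2 * p ^ 5 / 6553600 := by
            rw [hT]; field_simp; norm_num
          rw [e]
          have : 0 ≤ (n : ℝ) * (β ^ 2 * p ^ 5) := by positivity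
          linarith
    _ = _ := by ring
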